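/- Let $M\ge 1$, let $R$ be a positive definite Hermitian $M\times M$ matrix, and let $c>0$. Write $\mathbb{C}^+=\{z:\mathrm{Im}\,z>0\}$. For each $z\in\mathbb{C}^+$ there is a unique $t(z)$ with $t(z)\in\mathbb{C}^+$, $z\,t(z)\in\mathbb{C}^+$ and $$t(z)=\frac1M\,\mathrm{Tr}\,R\left(-zI_M-\frac{z\,c\,t(z)}{1-z\,c^2\,t(z)^2}\,R\right)^{-1}.$$ The function $t$ is the Stieltjes transform $t(z)=\int(\lambda-z)^{-1}\,d\mu(\lambda)$ of a finite positive measure $\mu$ carried by $[0,\infty)$. For every $x>0$ the limit $t(x)=\lim_{z\to x,\,z\in\mathbb{C}^+}t(z)$ exists, the function $f(x)=\frac1\pi\,\mathrm{Im}\,t(x)$ is continuous on $(0,\infty)$, and $f$ is the density of $\mu$ on $(0,\infty)$ with respect to Lebesgue measure. If $x_0>0$ and $\mathrm{Im}\,t(x_0)>0$, then $t$ and $f$ have convergent power series expansions around $x_0$: there are complex numbers $(a_k)_{k\ge0}$, real numbers $(b_k)_{k\ge0}$ and $\varepsilon>0$ such that, for all real $x$ with $|x-x_0|<\varepsilon$,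 $$t(x)=\sum_{k=0}^{\infty}a_k(x-x_0)^k,\qquad f(x)=\sum_{k=0}^{\infty}b_k(x-x_0)^k.$$ Hence $f$ is real analytic on $U=\{x>0:\mathrm{Im}\,t(x)>0\}$. Moreover $U$ is the set of those points of the interior of the support of $\mu$ at which $f$ does not vanish, and $U$ is dense in that interior. -/

import Mathlib

open MeasureTheory Filter Topology Set
open scoped ComplexOrder

noncomputable section

/-- `s` solves the canonical equation
`s = (1/M) Tr R (-z I - (z c s / (1 - z c² s²)) R)⁻¹` at the point `z`, subject to `s ∈ ℂ⁺` and
`z s ∈ ℂ⁺`. (For `z ∈ ℂ⁺` the two sign conditions force `1 - z c² s² ≠ 0`, and the equation with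
`Im s > 0` forces the matrix to be invertible.) -/
def IsCanonicalSolution {M : ℕ} (R : Matrix (Fin M) (Fin M) ℂ) (c : ℝ) (z s : ℂ) : Prop :=
  0 < s.im ∧ 0 < (z * s).im ∧
    s = (1 / (M : ℂ)) *
      (R * (-(z • (1 : Matrix (Fin M) (Fin M) ℂ)) -
        (z * c * s / (1 - z * (c : ℂ) ^ 2 * s ^ 2)) • R)⁻¹).trace

open Classical in
/-- The function `t` on the open upper half-plane: `t(z)` is the solution of the canonical
equation at `z`. -/
def canonicalT {M : ℕ} (R : Matrix (Fin M) (Fin M) ℂ) (c : ℝ) (z : ℂ) : ℂ :=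
  if h : ∃ s : ℂ, IsCanonicalSolution R c z s then h.choose else 0

/-- `μ` is a finite positive measure carried by `[0, ∞)` whose Stieltjes transform
`z ↦ ∫ (l - z)⁻¹ dμ(l)` coincides with `g` on the open upper half-plane. -/
def IsStieltjesMeasure (μ : Measure ℝ) (g : ℂ → ℂ) : Prop :=
  IsFiniteMeasure μ ∧ μ (Iio 0) = 0 ∧ ∀ z : ℂ, 0 < z.im → resolventTransform μ z = g z

open Classical in
/-- The measure `μ` whose Stieltjes transform is `t`. -/
def canonicalMeasure {M : ℕ} (R : Matrix (Fin M) (Fin M) ℂ) (c : ℝ) : Measure ℝ :=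
  if h : ∃ μ : Measure ℝ, IsStieltjesMeasure μ (canonicalT R c) then h.choose else 0

/-- The boundary value `t(x) = lim_{z → x, z ∈ ℂ⁺} t(z)` at a real point `x`. -/
def boundaryT {M : ℕ} (R : Matrix (Fin M) (Fin M) ℂ) (c : ℝ) (x : ℝ) : ℂ :=
  limUnder (𝓝[{z : ℂ | 0 < z.im}] (x : ℂ)) (canonicalT R c)

/-- The function `f(x) = (1/π) Im t(x)`. -/
def densityF {M : ℕ} (R : Matrix (Fin M) (Fin M) ℂ) (c : ℝ) (x : ℝ) : ℝ :=
  (1 / Real.pi) * (boundaryT R c x).im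

/-- The set of the points `x > 0` at which `Im t(x) > 0`. -/
def bulkSet {M : ℕ} (R : Matrix (Fin M) (Fin M) ℂ) (c : ℝ) : Set ℝ :=
  {x : ℝ | 0 < x ∧ 0 < (boundaryT R c x).im}

end

/-! The substitution `u = c t / (1 - z c² t²)`, equivalently `1/u = 1/(c t) - c z t`, turns the
canonical equation into `z t = -G(u)`, and eliminating `t` leaves `z = Z(u)` with `Z` an explicit
rational function. So `t` is obtained by inverting `Z` on the right branch
(`isCanonicalSolution_iff`).

Everything about the branch comes from one estimate, `OnCurve.contraction`. Taking imaginary parts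
of the equations gives a linear system with nonnegative coefficients satisfied by the positive pair
`(Im t, Im zt)`, and this forces `B |u|² (c + 1/(c |z| |t|²)) ≤ 1`, strictly when `Im z > 0`. With
Cauchy–Schwarz this gives uniqueness. It also gives `Z'(u) ≠ 0`, even at real `z` when `Im t > 0`:
there the strictness is recovered from the triangle inequality (`norm_add_one_div_lt`). Finally it
keeps `u` away from the poles of `G`, so that `z t` is bounded and `u` stays in a compact set of
regular points when `z` is near a nonzero point (`exists_isCompact`).

Existence is a connectedness argument in `ℂ⁺`: the set of solvable `z` is nonempty, open by the
local inverse, and closed by compactness. At a real `x ≠ 0`, the values `u(z)` can only accumulate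
at roots of `Z = x`; these are isolated and small half-discs are connected, so `u(z)` converges
(`exists_tendsto_uOf`).

The measure comes from a Herglotz representation on the disc, carried to the half-plane by the
Cayley transform; the bound on `z t` makes the measure finite
(`Nevanlinna.exists_stieltjes_measure`). Stieltjes inversion then identifies the density with `Im
t(x) / π` away from `0`, and both sign conditions together kill it on the negative axis.

At `x₀ > 0` with `Im t(x₀) > 0` the limiting `u` is a point of the curve with `Z' ≠ 0`, so the
holomorphic local inverse extends `t` across the axis: this is `exists_analytic_extension`, hence
the power series. The statements on the support follow from continuity of the density. -/

noncomputable section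

/-! ### The rational parametrization of the canonical equation -/

namespace CanonicalCurve

variable {M : ℕ}

/-- The function `G(u) = (1/M) ∑ λᵢ / (1 + u λᵢ)`. -/
def G (lam : Fin M → ℝ) (u : ℂ) : ℂ :=
  (1 / (M : ℂ)) * ∑ i, (lam i : ℂ) / (1 + u * lam i)

/-- The rational function `Z(u) = -c G(u) (1 - c u G(u)) / u`, which recovers `z` from the parameter
`u = c t / (1 - z c² t²)`. -/
def Z (lam : Fin M → ℝ) (c : ℝ) (u : ℂ) : ℂ :=
  -(c * G lam u * (1 - c * u * G lam u)) / u

/-- The parameter `u` lies in the upper half-plane above `z`, and so does the corresponding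
`t = -G(u)/z`. -/
structure OnCurve (lam : Fin M → ℝ) (c : ℝ) (z u : ℂ) : Prop where
  im_pos : 0 < u.im
  Z_eq : Z lam c u = z
  t_im_pos : 0 < (-G lam u / z).im

lemma one_add_mul_ne_zero {u : ℂ} (hu : 0 < u.im) (l : ℝ) : 1 + u * l ≠ 0 := by
  intro h
  have him := congrArg Complex.im h
  have hre := congrArg Complex.re h
  simp at him hre
  rcases him with h0 | h0
  · exact hu.ne' h0
  · simp [h0] at hre

lemma ne_zero_of_im_pos {u : ℂ} (hu : 0 < u.im) : u ≠ 0 := by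
  rintro rfl; simp at hu

lemma im_inv_pos_iff {u : ℂ} : 0 < (u⁻¹).im ↔ u.im < 0 := by
  by_cases hu : u = 0
  · simp [hu]
  · rw [Complex.inv_im, div_pos_iff_of_pos_right (Complex.normSq_pos.2 hu), neg_pos]

lemma im_inv_neg_iff {u : ℂ} : (u⁻¹).im < 0 ↔ 0 < u.im := by
  have := im_inv_pos_iff (u := u⁻¹)
  rw [inv_inv] at this
  exact this.symm

variable {R : Matrix (Fin M) (Fin M) ℂ}

/-- In an eigenbasis of `R` the matrix is diagonal with entries `-z (1 + w λᵢ)`, so `R` times its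
inverse has trace `-∑ λᵢ / (z (1 + w λᵢ))`. -/
lemma trace_resolvent (hR : R.IsHermitian) {z w : ℂ} (hz : z ≠ 0)
    (hw : ∀ i, 1 + w * (hR.eigenvalues i : ℂ) ≠ 0) :
    (1 / (M : ℂ)) * (R * (-(z • (1 : Matrix (Fin M) (Fin M) ℂ)) - (z * w) • R)⁻¹).trace =
      -G hR.eigenvalues w / z := by
  set φ := Unitary.conjStarAlgAut ℂ (Matrix (Fin M) (Fin M) ℂ) hR.eigenvectorUnitary with hφ
  set l : Fin M → ℂ := fun i => (hR.eigenvalues i : ℂ) with hl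
  have hRφ : R = φ (Matrix.diagonal l) := hR.spectral_theorem
  have hd : ∀ i, -z - z * w * l i ≠ 0 := by
    intro i
    have : -z - z * w * l i = -z * (1 + w * l i) := by ring
    rw [this]
    exact mul_ne_zero (neg_ne_zero.2 hz) (hw i)
  have hA : -(z • (1 : Matrix (Fin M) (Fin M) ℂ)) - (z * w) • R =
      φ (Matrix.diagonal fun i => -z - z * w * l i) := by
    rw [hRφ]
    have : (Matrix.diagonal fun i => -z - z * w * l i) =
        -(z • (1 : Matrix (Fin M) (Fin M) ℂ)) - (z * w) • Matrix.diagonal l := by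
      ext i j
      by_cases hij : i = j
      · subst hij; simp
      · simp [hij]
    rw [this, map_sub, map_neg, map_smul, map_smul, map_one]
  have hinv : (-(z • (1 : Matrix (Fin M) (Fin M) ℂ)) - (z * w) • R)⁻¹ =
      φ (Matrix.diagonal fun i => (-z - z * w * l i)⁻¹) := by
    apply Matrix.inv_eq_left_inv
    rw [hA, ← map_mul, Matrix.diagonal_mul_diagonal]
    have : (fun i => (-z - z * w * l i)⁻¹ * (-z - z * w * l i)) = fun _ => (1 : ℂ) := by
      funext i
      exact inv_mul_cancel₀ (hd i)
    rw [this, Matrix.diagonal_one, map_one]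
  have htr : ∀ X, (φ X).trace = X.trace := by
    intro X
    rw [hφ, Unitary.conjStarAlgAut_apply, Matrix.trace_mul_cycle]
    simp
  rw [hinv]
  nth_rewrite 1 [hRφ]
  rw [← map_mul, htr, Matrix.diagonal_mul_diagonal, Matrix.trace_diagonal, G]
  rw [neg_div, mul_div_assoc, ← mul_neg, Finset.sum_div, ← Finset.sum_neg_distrib]
  · congr 1
    refine Finset.sum_congr rfl fun i _ => ?_
    have h1 := hw i
    have h2 := hd i
    have h3 : -z - z * w * l i = -(z * (1 + w * l i)) := by ring
    rw [h3]
    change l i * _ = -(l i / (1 + w * l i) / z)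
    change 1 + w * l i ≠ 0 at h1
    field_simp

/-- Both `(c s)⁻¹` and `-c z s` have negative imaginary part, hence so has the inverse of the
parameter. A vanishing denominator would make that inverse `0` by the convention on division, which
is excluded by the sign. -/
lemma one_sub_ne_zero_of_im_pos {c : ℝ} (hc : 0 < c) {z s : ℂ} (hs : 0 < s.im)
    (hzs : 0 < (z * s).im) :
    (c * s / (1 - z * (c : ℂ) ^ 2 * s ^ 2))⁻¹ = (c * s : ℂ)⁻¹ - c * (z * s) ∧
      0 < (c * s / (1 - z * (c : ℂ) ^ 2 * s ^ 2)).im ∧ 1 - z * (c : ℂ) ^ 2 * s ^ 2 ≠ 0 := by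
  have hs0 := ne_zero_of_im_pos hs
  have hc0 : (c : ℂ) ≠ 0 := by exact_mod_cast hc.ne'
  have key : (c * s / (1 - z * (c : ℂ) ^ 2 * s ^ 2))⁻¹ = (c * s : ℂ)⁻¹ - c * (z * s) := by
    rw [inv_div]
    field_simp
  have him : ((c * s : ℂ)⁻¹ - c * (z * s)).im < 0 := by
    have h1 : ((c * s : ℂ)⁻¹).im < 0 := by
      rw [im_inv_neg_iff, Complex.im_ofReal_mul]
      positivity
    have h2 : (c * (z * s)).im = c * (z * s).im := Complex.im_ofReal_mul _ _
    rw [Complex.sub_im, h2]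
    have := mul_pos hc hzs
    linarith
  rw [← key] at him
  refine ⟨key, im_inv_neg_iff.1 him, ?_⟩
  intro h0
  rw [h0] at him
  simp at him

lemma G_im_eq (lam : Fin M → ℝ) (u : ℂ) :
    (G lam u).im = -(((1 / (M : ℝ)) * ∑ i, lam i ^ 2 / ‖1 + u * lam i‖ ^ 2) * u.im) := by
  have : (1 / (M : ℂ)) = ((1 / (M : ℝ) : ℝ) : ℂ) := by push_cast; rfl
  rw [G, this, Complex.im_ofReal_mul, Complex.im_sum, mul_assoc, ← mul_neg, Finset.sum_mul,
    ← Finset.sum_neg_distrib]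
  congr 1
  refine Finset.sum_congr rfl fun i _ => ?_
  rw [Complex.div_im, ← Complex.sq_norm]
  simp
  ring

lemma sum_sq_div_pos (hM : 0 < M) {lam : Fin M → ℝ} (hlam : ∀ i, 0 < lam i) {u : ℂ}
    (hu : ∀ i, 1 + u * lam i ≠ 0) :
    0 < (1 / (M : ℝ)) * ∑ i, lam i ^ 2 / ‖1 + u * lam i‖ ^ 2 := by
  have : Nonempty (Fin M) := ⟨⟨0, hM⟩⟩
  have hM' : (0 : ℝ) < M := by exact_mod_cast hM
  refine mul_pos (by positivity) (Finset.sum_pos (fun i _ => ?_) Finset.univ_nonempty)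
  have := norm_pos_iff.2 (hu i)
  have := hlam i
  positivity

lemma G_im_neg (hM : 0 < M) {lam : Fin M → ℝ} (hlam : ∀ i, 0 < lam i) {u : ℂ} (hu : 0 < u.im) :
    (G lam u).im < 0 := by
  rw [G_im_eq]
  have := mul_pos (sum_sq_div_pos hM hlam fun i => one_add_mul_ne_zero hu (lam i)) hu
  linarith

lemma OnCurve.ne_zero {lam : Fin M → ℝ} {c : ℝ} {z u : ℂ} (h : OnCurve lam c z u) : z ≠ 0 := by
  rintro rfl
  simpa using h.t_im_pos

lemma mul_t {lam : Fin M → ℝ} {z u : ℂ} (hz : z ≠ 0) : z * (-G lam u / z) = -G lam u := by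
  field_simp

lemma inv_eq_of_Z_eq {lam : Fin M → ℝ} {c : ℝ} (hc : 0 < c) {z u : ℂ} (hu : u ≠ 0)
    (hG : G lam u ≠ 0) (hz : z ≠ 0) (h : Z lam c u = z) :
    u⁻¹ = (c * (-G lam u / z) : ℂ)⁻¹ - c * (z * (-G lam u / z)) := by
  have hc0 : (c : ℂ) ≠ 0 := by exact_mod_cast hc.ne'
  rw [mul_t hz]
  have h1 : (c * (-G lam u / z) : ℂ)⁻¹ = - z / (c * G lam u) := by field_simp
  rw [h1, ← h, Z]
  field_simp
  ring

/-- The condition `Im (z s) > 0` has no counterpart in `OnCurve` because `z s = -G(u)` and `Im G(u)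
< 0` whenever `Im u > 0`. -/
lemma isCanonicalSolution_iff (hM : 0 < M) (hR : R.PosDef) {c : ℝ} (hc : 0 < c) {z s : ℂ}
    (hz : z ≠ 0) :
    IsCanonicalSolution R c z s ↔
      ∃ u, OnCurve hR.1.eigenvalues c z u ∧ s = -G hR.1.eigenvalues u / z := by
  have hc0 : (c : ℂ) ≠ 0 := by exact_mod_cast hc.ne'
  have hlam := fun i => hR.eigenvalues_pos i
  constructor
  · rintro ⟨hs, hzs, heq⟩
    obtain ⟨h1, h2, h3⟩ := one_sub_ne_zero_of_im_pos hc hs hzs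
    set w := c * s / (1 - z * (c : ℂ) ^ 2 * s ^ 2) with hw
    have hzw : z * c * s / (1 - z * (c : ℂ) ^ 2 * s ^ 2) = z * w := by rw [hw]; ring
    rw [hzw, trace_resolvent hR.1 hz fun i => one_add_mul_ne_zero h2 _] at heq
    have hG : G hR.1.eigenvalues w = -(z * s) := by rw [heq, mul_t hz, neg_neg]
    have hs0 := ne_zero_of_im_pos hs
    refine ⟨w, ⟨h2, ?_, by rwa [← heq]⟩, heq⟩
    rw [Z, hG, div_eq_mul_inv]
    have hw0 := ne_zero_of_im_pos h2
    have : -(↑c * -(z * s) * (1 - ↑c * w * -(z * s))) * w⁻¹ =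
        c * (z * s) * (w⁻¹ + c * (z * s)) := by field_simp; ring
    rw [this, h1]
    field_simp
    ring
  · rintro ⟨u, hu, rfl⟩
    have hG := G_im_neg hM hlam hu.im_pos
    have hG0 : G hR.1.eigenvalues u ≠ 0 := by intro h; simp [h] at hG
    have hu0 := ne_zero_of_im_pos hu.im_pos
    set s := -G hR.1.eigenvalues u / z with hs
    have hzs : 0 < (z * s).im := by rw [hs, mul_t hz]; simpa using hG
    obtain ⟨h1, h2, h3⟩ := one_sub_ne_zero_of_im_pos hc hu.t_im_pos hzs
    have hinv := inv_eq_of_Z_eq hc hu0 hG0 hz hu.Z_eq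
    rw [← hs, ← h1, inv_inj] at hinv
    refine ⟨hu.t_im_pos, hzs, ?_⟩
    have hzw : z * c * s / (1 - z * (c : ℂ) ^ 2 * s ^ 2) =
      z * (c * s / (1 - z * (c : ℂ) ^ 2 * s ^ 2)) := by ring
    rw [hzw, ← hinv, trace_resolvent hR.1 hz fun i => one_add_mul_ne_zero hu.im_pos _]

end CanonicalCurve

namespace CanonicalCurve

variable {M : ℕ}

/-! ### Contraction estimates -/

/-- `B(u) = (1/M) ∑ λᵢ² / |1 + u λᵢ|²`. -/
def B (lam : Fin M → ℝ) (u : ℂ) : ℝ :=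
  (1 / (M : ℝ)) * ∑ i, lam i ^ 2 / ‖1 + u * lam i‖ ^ 2

/-- `D(u) = (1/M) ∑ λᵢ / |1 + u λᵢ|²`. -/
def D (lam : Fin M → ℝ) (u : ℂ) : ℝ :=
  (1 / (M : ℝ)) * ∑ i, lam i / ‖1 + u * lam i‖ ^ 2

lemma B_nonneg (lam : Fin M → ℝ) (u : ℂ) : 0 ≤ B lam u := by
  unfold B; positivity

lemma D_pos (hM : 0 < M) {lam : Fin M → ℝ} (hlam : ∀ i, 0 < lam i) {u : ℂ}
    (hu : ∀ i, 1 + u * lam i ≠ 0) : 0 < D lam u := by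
  have : Nonempty (Fin M) := ⟨⟨0, hM⟩⟩
  have hM' : (0 : ℝ) < M := by exact_mod_cast hM
  refine mul_pos (by positivity) (Finset.sum_pos (fun i _ => ?_) Finset.univ_nonempty)
  have := norm_pos_iff.2 (hu i)
  have := hlam i
  positivity

lemma t_im_eq (lam : Fin M → ℝ) {z u : ℂ} :
    (-G lam u / z).im = (D lam u * z.im + B lam u * (z * u).im) / ‖z‖ ^ 2 := by
  have h : -G lam u / z = ((1 / (M : ℝ) : ℝ) : ℂ) * ∑ i, -((lam i : ℂ) * (z * (1 + u * lam i))⁻¹) := by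
    rw [G, neg_div, mul_div_assoc, ← mul_neg, Finset.sum_div, ← Finset.sum_neg_distrib]
    push_cast
    congr 1
    refine Finset.sum_congr rfl fun i _ => ?_
    rw [div_div, div_eq_mul_inv, mul_comm z]
  rw [h, Complex.im_ofReal_mul, Complex.im_sum, D, B, mul_assoc, mul_assoc, ← mul_add, mul_div_assoc,
    Finset.sum_mul, Finset.sum_mul, ← Finset.sum_add_distrib, Finset.sum_div]
  congr 1
  refine Finset.sum_congr rfl fun i _ => ?_
  rw [Complex.neg_im, Complex.im_ofReal_mul, Complex.inv_im, ← Complex.sq_norm, norm_mul, mul_pow]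
  have : (z * (1 + u * lam i)).im = z.im + lam i * (z * u).im := by simp; ring
  rw [this]
  ring

lemma im_eq_of_inv_im {u x : ℂ} (h : u⁻¹.im = x.im) : u.im = ‖u‖ ^ 2 * -x.im := by
  by_cases hu : u = 0
  · simp [hu]
  · have hu' : ‖u‖ ^ 2 ≠ 0 := by positivity
    rw [Complex.inv_im, ← Complex.sq_norm] at h
    rw [← h]; field_simp

/-- The relation has a symmetry: dividing it by `z` gives the same relation for `z u`, with `t` and
`z t` exchanged. Each half is the imaginary part of one of the two forms. -/
lemma im_formulas {c : ℝ} {u z t : ℂ} (hz : z ≠ 0)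
    (h : u⁻¹ = (c * t : ℂ)⁻¹ - c * (z * t)) :
    u.im = ‖u‖ ^ 2 * (t.im / (c * ‖t‖ ^ 2) + c * (z * t).im) ∧
    (z * u).im = ‖z‖ ^ 2 * ‖u‖ ^ 2 * ((z * t).im / (c * (‖z‖ ^ 2 * ‖t‖ ^ 2)) + c * t.im) := by
  have key : ∀ s w : ℂ, ((c * s : ℂ)⁻¹ - c * w).im = - (s.im / (c * ‖s‖ ^ 2) + c * w.im) := by
    intro s w
    rw [Complex.sub_im, Complex.im_ofReal_mul, Complex.inv_im, Complex.im_ofReal_mul,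
      ← Complex.sq_norm, norm_mul, Complex.norm_real, mul_pow, Real.norm_eq_abs, sq_abs]
    by_cases hc : c = 0
    · simp [hc]
    by_cases hs : s = 0
    · simp [hs]
    field_simp
    ring
  constructor
  · rw [im_eq_of_inv_im (congrArg Complex.im h), key, neg_neg]
  · have h2 : (z * u)⁻¹ = (c * (z * t) : ℂ)⁻¹ - c * t := by
      rw [mul_inv, h]
      by_cases hc : c = 0
      · simp [hc]
      have hc0 : (c : ℂ) ≠ 0 := by exact_mod_cast hc
      by_cases ht : t = 0
      · simp [ht]
      field_simp
    rw [im_eq_of_inv_im (congrArg Complex.im h2), key, neg_neg, norm_mul, norm_mul, mul_pow, mul_pow]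

section
variable {lam : Fin M → ℝ} {c : ℝ} {z u : ℂ}

lemma OnCurve.G_ne_zero (hM : 0 < M) (hlam : ∀ i, 0 < lam i) (h : OnCurve lam c z u) :
    G lam u ≠ 0 := by
  intro h0
  simpa [h0] using G_im_neg hM hlam h.im_pos

lemma OnCurve.zt_im_pos (hM : 0 < M) (hlam : ∀ i, 0 < lam i) (h : OnCurve lam c z u) :
    0 < (z * (-G lam u / z)).im := by
  rw [mul_t h.ne_zero]
  simpa using G_im_neg hM hlam h.im_pos

lemma OnCurve.inv_eq (hM : 0 < M) (hlam : ∀ i, 0 < lam i) (hc : 0 < c) (h : OnCurve lam c z u) :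
    u⁻¹ = (c * (-G lam u / z) : ℂ)⁻¹ - c * (z * (-G lam u / z)) :=
  inv_eq_of_Z_eq hc (ne_zero_of_im_pos h.im_pos) (h.G_ne_zero hM hlam) h.ne_zero h.Z_eq

lemma OnCurve.zu_im_pos (hM : 0 < M) (hlam : ∀ i, 0 < lam i) (hc : 0 < c) (h : OnCurve lam c z u) :
    0 < (z * u).im := by
  rw [(im_formulas h.ne_zero (h.inv_eq hM hlam hc)).2]
  have h1 := h.t_im_pos
  have h2 := h.zt_im_pos hM hlam
  have h3 := norm_pos_iff.2 h.ne_zero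
  have h4 := norm_pos_iff.2 (ne_zero_of_im_pos h.im_pos)
  positivity

/-- Eliminating `b` gives `x² = x D / a + (p / r)²`, and `x > 0` by the first equation. It is the
elementary form of a Perron–Frobenius bound: a positive vector fixed up to a nonnegative defect
bounds the spectral radius. -/
lemma contraction_aux {a b p x r D : ℝ} (ha : 0 < a) (hb : 0 < b) (hp : 0 < p) (hr : 0 < r)
    (hD : 0 ≤ D) (h1 : x * b = p * a) (h2 : x * a = D + p * b / r ^ 2) :
    p / r ≤ x ∧ (0 < D → p / r < x) := by
  have hx : 0 < x := by
    have : 0 < x * b := by rw [h1]; positivity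
    exact pos_of_mul_pos_left this hb.le
  have h3 : x ^ 2 = x * D / a + (p / r) ^ 2 := by
    have : x * (x * a) = x * D + p * (x * b) / r ^ 2 := by rw [h2]; ring
    rw [h1] at this
    field_simp at this ⊢
    nlinarith
  constructor
  · refine le_of_sq_le_sq ?_ hx.le
    rw [h3]
    have : 0 ≤ x * D / a := by positivity
    linarith
  · intro hD'
    refine lt_of_pow_lt_pow_left₀ 2 hx.le ?_
    rw [h3]
    have : 0 < x * D / a := by positivity
    linarith

lemma OnCurve.contraction (hM : 0 < M) (hlam : ∀ i, 0 < lam i) (hc : 0 < c)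
    (h : OnCurve lam c z u) (hz : 0 ≤ z.im) :
    B lam u * ‖u‖ ^ 2 * (c + 1 / (c * ‖z‖ * ‖-G lam u / z‖ ^ 2)) ≤ 1 ∧
      (0 < z.im → B lam u * ‖u‖ ^ 2 * (c + 1 / (c * ‖z‖ * ‖-G lam u / z‖ ^ 2)) < 1) := by
  obtain ⟨h1, h2⟩ := im_formulas h.ne_zero (h.inv_eq hM hlam hc)
  have hr := norm_pos_iff.2 h.ne_zero
  have hu := norm_pos_iff.2 (ne_zero_of_im_pos h.im_pos)
  have ha := h.t_im_pos
  have hb := h.zt_im_pos hM hlam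
  have hbe : (z * (-G lam u / z)).im = B lam u * u.im := by
    rw [mul_t h.ne_zero, Complex.neg_im, G_im_eq, neg_neg, B]
  have hae := t_im_eq lam (z := z) (u := u)
  have ht := norm_pos_iff.2 (ne_zero_of_im_pos h.t_im_pos)
  set t := -G lam u / z
  have hB : 0 < B lam u := by
    have := sum_sq_div_pos hM hlam fun i => one_add_mul_ne_zero h.im_pos (lam i)
    exact this
  have hD := D_pos hM hlam fun i => one_add_mul_ne_zero h.im_pos (lam i)
  rw [h1] at hbe
  rw [h2] at hae
  set a := t.im
  set b := (z * t).im
  -- Substituting the formulas for `Im u` and `Im zu` into `Im zt = B Im u` and `|z|² Im t = D Im z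
  -- + B Im zu` gives the system in `a = Im t`, `b = Im zt`; the defect is proportional to `Im z`.
  have key := contraction_aux (p := B lam u * ‖u‖ ^ 2 * (1 / (c * ‖t‖ ^ 2)))
    (x := 1 - B lam u * ‖u‖ ^ 2 * c) (D := D lam u * z.im / ‖z‖ ^ 2) ha hb (by positivity) hr
    (by positivity) (by linear_combination hbe)
    (by
      have h3 : a - B lam u * ‖u‖ ^ 2 * c * a = D lam u * z.im / ‖z‖ ^ 2 +
          B lam u * ‖u‖ ^ 2 * (1 / (c * ‖t‖ ^ 2)) * b / ‖z‖ ^ 2 := by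
        nth_rewrite 1 [hae]
        field_simp
        ring
      linear_combination h3)
  have h4 : B lam u * ‖u‖ ^ 2 * (c + 1 / (c * ‖z‖ * ‖t‖ ^ 2)) =
      B lam u * ‖u‖ ^ 2 * c + B lam u * ‖u‖ ^ 2 * (1 / (c * ‖t‖ ^ 2)) / ‖z‖ := by
    field_simp
  rw [h4]
  refine ⟨by linarith [key.1], fun hz' => ?_⟩
  have := key.2 (by positivity)
  linarith

/-! ### Divided differences, Cauchy–Schwarz and uniqueness -/

/-- `A(u, v) = (1/M) ∑ λᵢ² u v / ((1 + u λᵢ)(1 + v λᵢ))`. -/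
def A (lam : Fin M → ℝ) (u v : ℂ) : ℂ :=
  (1 / (M : ℂ)) * ∑ i, (lam i : ℂ) ^ 2 * u * v / ((1 + u * lam i) * (1 + v * lam i))

lemma norm_A_sq_le (lam : Fin M → ℝ) (u v : ℂ) :
    ‖A lam u v‖ ^ 2 ≤ (B lam u * ‖u‖ ^ 2) * (B lam v * ‖v‖ ^ 2) := by
  have h1 : ‖A lam u v‖ ≤ (1 / (M : ℝ)) * ∑ i, (|lam i| / ‖1 + u * lam i‖ * ‖u‖) *
      (|lam i| / ‖1 + v * lam i‖ * ‖v‖) := by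
    rw [A, norm_mul]
    have : ‖(1 / (M : ℂ))‖ = 1 / (M : ℝ) := by simp
    rw [this]
    refine mul_le_mul_of_nonneg_left ((norm_sum_le _ _).trans (Finset.sum_le_sum fun i _ => ?_))
      (by positivity)
    simp only [norm_div, norm_mul, norm_pow, Complex.norm_real, Real.norm_eq_abs]
    apply le_of_eq
    ring
  have h2 := Finset.sum_mul_sq_le_sq_mul_sq Finset.univ
    (fun i => |lam i| / ‖1 + u * lam i‖ * ‖u‖) (fun i => |lam i| / ‖1 + v * lam i‖ * ‖v‖)
  have h3 : ∀ w : ℂ, ∑ i, (|lam i| / ‖1 + w * lam i‖ * ‖w‖) ^ 2 =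
      (∑ i, lam i ^ 2 / ‖1 + w * lam i‖ ^ 2) * ‖w‖ ^ 2 := by
    intro w
    rw [Finset.sum_mul]
    refine Finset.sum_congr rfl fun i _ => ?_
    rw [mul_pow, div_pow, sq_abs]
  rw [h3, h3] at h2
  calc ‖A lam u v‖ ^ 2 ≤ _ := pow_le_pow_left₀ (norm_nonneg _) h1 2
    _ = (1 / (M : ℝ)) ^ 2 * (∑ i, (|lam i| / ‖1 + u * lam i‖ * ‖u‖) *
      (|lam i| / ‖1 + v * lam i‖ * ‖v‖)) ^ 2 := by ring
    _ ≤ (1 / (M : ℝ)) ^ 2 * _ := mul_le_mul_of_nonneg_left h2 (by positivity)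
    _ = _ := by rw [B, B]; ring

lemma norm_A_self_le (lam : Fin M → ℝ) (u : ℂ) : ‖A lam u u‖ ≤ B lam u * ‖u‖ ^ 2 := by
  have h := norm_A_sq_le lam u u
  rw [← sq] at h
  exact le_of_sq_le_sq h (mul_nonneg (B_nonneg _ _) (sq_nonneg _))

/-- A resolvent identity: `z (t₁ - t₂) = A (1/u₂ - 1/u₁)`, and `1/u = 1/(c t) - c z t` makes the
last difference a multiple of `t₁ - t₂`. Uniqueness reduces to showing that the multiplier is not
`1`. -/
lemma t_sub_eq {u₁ u₂ : ℂ} (hM : 0 < M) (hlam : ∀ i, 0 < lam i) (hc : 0 < c)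
    (h₁ : OnCurve lam c z u₁) (h₂ : OnCurve lam c z u₂) :
    -G lam u₁ / z - -G lam u₂ / z = (-G lam u₁ / z - -G lam u₂ / z) *
      (A lam u₁ u₂ * (c + 1 / (c * z * (-G lam u₁ / z) * (-G lam u₂ / z)))) := by
  have hz := h₁.ne_zero
  have hc0 : (c : ℂ) ≠ 0 := by exact_mod_cast hc.ne'
  have hu₁ := ne_zero_of_im_pos h₁.im_pos
  have hu₂ := ne_zero_of_im_pos h₂.im_pos
  have e₁ := h₁.inv_eq hM hlam hc
  have e₂ := h₂.inv_eq hM hlam hc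
  have ht₁ := ne_zero_of_im_pos h₁.t_im_pos
  have ht₂ := ne_zero_of_im_pos h₂.t_im_pos
  have hA : z * (-G lam u₁ / z - -G lam u₂ / z) = A lam u₁ u₂ * (u₂⁻¹ - u₁⁻¹) := by
    rw [mul_sub, mul_t hz, mul_t hz, G, G, A, mul_assoc, Finset.sum_mul, ← mul_neg, ← mul_neg,
      ← mul_sub, ← Finset.sum_neg_distrib, ← Finset.sum_neg_distrib, ← Finset.sum_sub_distrib]
    congr 1
    refine Finset.sum_congr rfl fun i _ => ?_
    have h1 := one_add_mul_ne_zero h₁.im_pos (lam i)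
    have h2 := one_add_mul_ne_zero h₂.im_pos (lam i)
    rw [neg_sub_neg, div_sub_div _ _ h2 h1, inv_sub_inv hu₂ hu₁, div_mul_div_comm,
      div_eq_div_iff (mul_ne_zero h2 h1) (mul_ne_zero (mul_ne_zero h1 h2) (mul_ne_zero hu₂ hu₁))]
    ring
  rw [e₁, e₂] at hA
  set t₁ := -G lam u₁ / z
  set t₂ := -G lam u₂ / z
  have h3 : t₁ - t₂ = z⁻¹ * (z * (t₁ - t₂)) := by field_simp
  rw [hA] at h3
  refine h3.trans ?_
  field_simp
  ring

lemma mix_aux {x y c e : ℝ} (hc : 0 ≤ c) (he : 0 ≤ e) :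
    (c + e * (x * y)) ^ 2 ≤ (c + e * x ^ 2) * (c + e * y ^ 2) := by
  have := mul_nonneg (mul_nonneg hc he) (sq_nonneg (x - y))
  nlinarith

/-- Uniqueness of the point of the curve above `z`. -/
lemma OnCurve.t_unique {u₁ u₂ : ℂ} (hM : 0 < M) (hlam : ∀ i, 0 < lam i) (hc : 0 < c)
    (hz : 0 < z.im) (h₁ : OnCurve lam c z u₁) (h₂ : OnCurve lam c z u₂) :
    -G lam u₁ / z = -G lam u₂ / z := by
  by_contra hne
  have hsub := t_sub_eq hM hlam hc h₁ h₂
  have hK : A lam u₁ u₂ * (c + 1 / (c * z * (-G lam u₁ / z) * (-G lam u₂ / z))) = 1 :=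
    (mul_left_cancel₀ (sub_ne_zero.2 hne) ((mul_one _).trans hsub)).symm
  have c₁ := (h₁.contraction hM hlam hc hz.le).2 hz
  have c₂ := (h₂.contraction hM hlam hc hz.le).2 hz
  have hr := norm_pos_iff.2 h₁.ne_zero
  have ht₁ := norm_pos_iff.2 (ne_zero_of_im_pos h₁.t_im_pos)
  have ht₂ := norm_pos_iff.2 (ne_zero_of_im_pos h₂.t_im_pos)
  set t₁ := -G lam u₁ / z
  set t₂ := -G lam u₂ / z
  have hA := norm_A_sq_le lam u₁ u₂
  have hb₁ : 0 ≤ B lam u₁ * ‖u₁‖ ^ 2 := mul_nonneg (B_nonneg _ _) (sq_nonneg _)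
  have hb₂ : 0 ≤ B lam u₂ * ‖u₂‖ ^ 2 := mul_nonneg (B_nonneg _ _) (sq_nonneg _)
  have hn : ‖(c + 1 / (c * z * t₁ * t₂) : ℂ)‖ ≤ c + 1 / (c * ‖z‖) * (‖t₁‖⁻¹ * ‖t₂‖⁻¹) := by
    refine (norm_add_le _ _).trans (le_of_eq ?_)
    simp only [norm_div, norm_mul, norm_one, Complex.norm_real, Real.norm_eq_abs, abs_of_pos hc]
    field_simp
  -- A second Cauchy–Schwarz, for the factor `c + 1/(c z t₁ t₂)`, so that the squared multiplier is
  -- at most the product of the two contraction constants.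
  have hmix := mix_aux (x := ‖t₁‖⁻¹) (y := ‖t₂‖⁻¹) (c := c) (e := 1 / (c * ‖z‖)) hc.le (by positivity)
  have e : ∀ t : ℂ, 1 / (c * ‖z‖ * ‖t‖ ^ 2) = 1 / (c * ‖z‖) * ‖t‖⁻¹ ^ 2 := by
    intro t; rw [one_div, one_div, mul_inv, inv_pow]
  rw [e] at c₁ c₂
  have h1 : (1 : ℝ) ≤ (B lam u₁ * ‖u₁‖ ^ 2 * (c + 1 / (c * ‖z‖) * ‖t₁‖⁻¹ ^ 2)) *
      (B lam u₂ * ‖u₂‖ ^ 2 * (c + 1 / (c * ‖z‖) * ‖t₂‖⁻¹ ^ 2)) := by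
    calc (1 : ℝ) = ‖A lam u₁ u₂ * (c + 1 / (c * z * t₁ * t₂))‖ ^ 2 := by rw [hK]; simp
      _ = ‖A lam u₁ u₂‖ ^ 2 * ‖(c + 1 / (c * z * t₁ * t₂) : ℂ)‖ ^ 2 := by rw [norm_mul, mul_pow]
      _ ≤ ((B lam u₁ * ‖u₁‖ ^ 2) * (B lam u₂ * ‖u₂‖ ^ 2)) *
          ((c + 1 / (c * ‖z‖) * ‖t₁‖⁻¹ ^ 2) * (c + 1 / (c * ‖z‖) * ‖t₂‖⁻¹ ^ 2)) := by
        gcongr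
        exact (pow_le_pow_left₀ (norm_nonneg _) hn 2).trans hmix
      _ = _ := by ring
  have h2 : (B lam u₁ * ‖u₁‖ ^ 2 * (c + 1 / (c * ‖z‖) * ‖t₁‖⁻¹ ^ 2)) *
      (B lam u₂ * ‖u₂‖ ^ 2 * (c + 1 / (c * ‖z‖) * ‖t₂‖⁻¹ ^ 2)) < 1 :=
    mul_lt_one_of_nonneg_of_lt_one_left (by positivity) c₁ c₂.le
  linarith

lemma OnCurve.unique {u₁ u₂ : ℂ} (hM : 0 < M) (hlam : ∀ i, 0 < lam i) (hc : 0 < c)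
    (hz : 0 < z.im) (h₁ : OnCurve lam c z u₁) (h₂ : OnCurve lam c z u₂) : u₁ = u₂ := by
  have := h₁.t_unique hM hlam hc hz h₂
  rw [← inv_inj, h₁.inv_eq hM hlam hc, h₂.inv_eq hM hlam hc, this]

/-- Equality in the triangle inequality would make `t²` a positive real, impossible when `Im t > 0`.
This supplies the strict inequality at real points, where the contraction estimate has only `≤`. -/
lemma norm_add_one_div_lt {x : ℝ} {t : ℂ} (hx : 0 < x) (hc : 0 < c) (ht : 0 < t.im) :
    ‖(c + 1 / (c * x * t * t) : ℂ)‖ < c + 1 / (c * x * ‖t‖ ^ 2) := by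
  have ht0 := ne_zero_of_im_pos ht
  have hn : ‖(1 / (c * x * t * t) : ℂ)‖ = 1 / (c * x * ‖t‖ ^ 2) := by
    simp only [norm_div, norm_mul, norm_one, Complex.norm_real, Real.norm_eq_abs, abs_of_pos hc,
      abs_of_pos hx]
    ring
  refine lt_of_le_of_ne ?_ ?_
  · refine (norm_add_le _ _).trans (le_of_eq ?_)
    rw [hn, Complex.norm_real, Real.norm_eq_abs, abs_of_pos hc]
  · intro h
    have h' : ‖(c + 1 / (c * x * t * t) : ℂ)‖ = ‖(c : ℂ)‖ + ‖(1 / (c * x * t * t) : ℂ)‖ := by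
      rw [h, hn, Complex.norm_real, Real.norm_eq_abs, abs_of_pos hc]
    have hray := sameRay_iff_norm_add.2 h'
    have hc0 : (c : ℂ) ≠ 0 := by exact_mod_cast hc.ne'
    have hx0 : (x : ℂ) ≠ 0 := by exact_mod_cast hx.ne'
    obtain ⟨r, hr, hr'⟩ := hray.exists_pos_left hc0 (by positivity)
    have h3 : t ^ 2 = ((1 / (r * c ^ 2 * x) : ℝ) : ℂ) := by
      rw [Complex.real_smul] at hr'
      have hr0 : (r : ℂ) ≠ 0 := by exact_mod_cast hr.ne'
      push_cast
      field_simp at hr' ⊢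
      linear_combination hr'
    have him := congrArg Complex.im h3
    have hre := congrArg Complex.re h3
    rw [Complex.ofReal_im, sq, Complex.mul_im] at him
    rw [Complex.ofReal_re, sq, Complex.mul_re] at hre
    have hre0 : t.re = 0 := by
      have : t.re * t.im = 0 := by linarith
      exact (mul_eq_zero.1 this).resolve_right ht.ne'
    rw [hre0] at hre
    have : 0 < 1 / (r * c ^ 2 * x) := by positivity
    nlinarith

lemma OnCurve.norm_A_mul_lt (hM : 0 < M) (hlam : ∀ i, 0 < lam i) (hc : 0 < c)
    (h : OnCurve lam c z u) (hz : 0 ≤ z.im) :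
    ‖A lam u u * (c + 1 / (c * z * (-G lam u / z) * (-G lam u / z)))‖ < 1 := by
  have hcon := h.contraction hM hlam hc hz
  have hr := norm_pos_iff.2 h.ne_zero
  have ht := norm_pos_iff.2 (ne_zero_of_im_pos h.t_im_pos)
  have htim := h.t_im_pos
  have hzt := h.zt_im_pos hM hlam
  have hA := norm_A_self_le lam u
  have hB : 0 < B lam u := sum_sq_div_pos hM hlam fun i => one_add_mul_ne_zero h.im_pos (lam i)
  have hu := norm_pos_iff.2 (ne_zero_of_im_pos h.im_pos)
  set t := -G lam u / z
  have hn : ‖(c + 1 / (c * z * t * t) : ℂ)‖ ≤ c + 1 / (c * ‖z‖ * ‖t‖ ^ 2) := by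
    refine (norm_add_le _ _).trans (le_of_eq ?_)
    simp only [norm_div, norm_mul, norm_one, Complex.norm_real, Real.norm_eq_abs, abs_of_pos hc]
    field_simp
  rw [norm_mul]
  rcases hz.lt_or_eq with hz | hz
  · calc _ ≤ B lam u * ‖u‖ ^ 2 * (c + 1 / (c * ‖z‖ * ‖t‖ ^ 2)) := by gcongr
      _ < 1 := hcon.2 hz
  · have hzr : z = (z.re : ℂ) := Complex.ext rfl (by simp [← hz])
    have hpos : 0 < z.re := by
      rw [hzr, Complex.im_ofReal_mul] at hzt
      exact pos_of_mul_pos_left hzt htim.le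
    have hlt := norm_add_one_div_lt (x := z.re) hpos hc htim
    rw [← hzr] at hlt
    have hzn : ‖z‖ = z.re := by
      rw [hzr, Complex.norm_real, Complex.ofReal_re, Real.norm_eq_abs, abs_of_pos hpos]
    rw [← hzn] at hlt
    calc _ ≤ B lam u * ‖u‖ ^ 2 * ‖(c + 1 / (c * z * t * t) : ℂ)‖ := by gcongr
      _ < B lam u * ‖u‖ ^ 2 * (c + 1 / (c * ‖z‖ * ‖t‖ ^ 2)) := by gcongr
      _ ≤ 1 := hcon.1

end
end CanonicalCurve

namespace CanonicalCurve

variable {M : ℕ}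

/-! ### The derivative of `Z` and local inverses -/

section
variable {lam : Fin M → ℝ} {c : ℝ} {z u : ℂ}

lemma hasStrictDerivAt_G (hu0 : u ≠ 0) (hu : ∀ i, 1 + u * lam i ≠ 0) :
    HasStrictDerivAt (G lam) (-A lam u u / u ^ 2) u := by
  have h : ∀ i ∈ Finset.univ, HasStrictDerivAt (fun u : ℂ => (lam i : ℂ) / (1 + u * lam i))
      (-((lam i : ℂ) * lam i) / (1 + u * lam i) ^ 2) u := by
    intro i _
    have h1 : HasStrictDerivAt (fun u : ℂ => 1 + u * lam i) (lam i : ℂ) u := by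
      simpa using ((hasStrictDerivAt_id u).mul_const (lam i : ℂ)).const_add 1
    simpa using (hasStrictDerivAt_const u (lam i : ℂ)).fun_div h1 (hu i)
  have h2 := (HasStrictDerivAt.fun_sum h).const_mul (1 / (M : ℂ))
  convert! h2 using 1
  rw [A, ← mul_neg, mul_div_assoc, ← Finset.sum_neg_distrib, Finset.sum_div]
  congr 1
  refine Finset.sum_congr rfl fun i _ => ?_
  have := hu i
  field_simp

lemma continuousAt_G (hu : ∀ i, 1 + u * lam i ≠ 0) : ContinuousAt (G lam) u := by
  unfold G
  refine continuousAt_const.mul (tendsto_finsetSum _ fun i _ => ?_)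
  exact ContinuousAt.div continuousAt_const (by fun_prop) (hu i)

lemma continuousAt_Z (hu0 : u ≠ 0) (hu : ∀ i, 1 + u * lam i ≠ 0) : ContinuousAt (Z lam c) u := by
  unfold Z
  have := continuousAt_G hu
  exact ContinuousAt.div (by fun_prop) continuousAt_id hu0

lemma hasStrictDerivAt_Z (hu0 : u ≠ 0) (hu : ∀ i, 1 + u * lam i ≠ 0) :
    HasStrictDerivAt (Z lam c) (-((c * (-A lam u u / u ^ 2) * (1 - c * u * G lam u) +
      c * G lam u * -(c * G lam u + c * u * (-A lam u u / u ^ 2))) * u -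
      c * G lam u * (1 - c * u * G lam u)) / u ^ 2) u := by
  have hG := hasStrictDerivAt_G hu0 hu
  have h1 : HasStrictDerivAt (fun u : ℂ => (c : ℂ) * u) c u := by
    simpa using (hasStrictDerivAt_id u).const_mul (c : ℂ)
  have h2 := ((hG.const_mul (c : ℂ)).mul ((h1.mul hG).const_sub 1)).neg.div
    (hasStrictDerivAt_id u) hu0
  convert! h2 using 1
  simp
  ring

lemma analyticAt_Z (hu0 : u ≠ 0) (hu : ∀ i, 1 + u * lam i ≠ 0) : AnalyticAt ℂ (Z lam c) u := by
  have h : ∀ᶠ v : ℂ in 𝓝 u, v ≠ 0 ∧ ∀ i, 1 + v * lam i ≠ 0 := by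
    refine (continuousAt_id.eventually_ne hu0).and (eventually_all.2 fun i => ?_)
    exact ContinuousAt.eventually_ne (g := fun v : ℂ => 1 + v * lam i) (by fun_prop) (hu i)
  rw [Complex.analyticAt_iff_eventually_differentiableAt]
  filter_upwards [h] with v hv
  exact (hasStrictDerivAt_Z hv.1 hv.2).hasDerivAt.differentiableAt

/-- On the curve `Z'(u) = (c G / u²) (1 - A(u,u) (c + 1/(c z t²)))`, and the subtracted term has
modulus less than `1` by `OnCurve.norm_A_mul_lt`. -/
lemma OnCurve.deriv_Z_ne_zero (hM : 0 < M) (hlam : ∀ i, 0 < lam i) (hc : 0 < c)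
    (h : OnCurve lam c z u) (hz : 0 ≤ z.im) :
    ∃ d : ℂ, d ≠ 0 ∧ HasStrictDerivAt (Z lam c) d u := by
  have hu0 := ne_zero_of_im_pos h.im_pos
  have hu := fun i => one_add_mul_ne_zero h.im_pos (lam i)
  refine ⟨_, ?_, hasStrictDerivAt_Z hu0 hu⟩
  have hG := h.G_ne_zero hM hlam
  have hc0 : (c : ℂ) ≠ 0 := by exact_mod_cast hc.ne'
  have hK := h.norm_A_mul_lt hM hlam hc hz
  have hz0 := h.ne_zero
  have hZ := h.Z_eq
  rw [Z] at hZ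
  have h1 : (1 / (c * z * (-G lam u / z) * (-G lam u / z)) : ℂ) =
      -((1 - c * u * G lam u) / (u * G lam u)) := by
    have : (1 / (c * z * (-G lam u / z) * (-G lam u / z)) : ℂ) = z / (c * G lam u ^ 2) := by
      field_simp
    rw [this, ← hZ]
    field_simp
  rw [h1] at hK
  intro h0
  have h2 : A lam u u * (c + -((1 - c * u * G lam u) / (u * G lam u))) = 1 := by
    have h3 : (c * G lam u / u ^ 2) *
        (1 - A lam u u * (c + -((1 - c * u * G lam u) / (u * G lam u)))) = 0 := by
      rw [← h0]
      field_simp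
      ring
    have h4 := (mul_eq_zero.1 h3).resolve_left (by positivity)
    linear_combination -h4
  rw [h2] at hK
  simp at hK

/-- The inverse function theorem for `Z`; the strict sign conditions persist by continuity. Real
`z₀` is allowed, and the neighbourhood is a full one: this is what later continues `t` across the
axis. -/
lemma OnCurve.exists_local_inverse {z₀ u₀ : ℂ} (hM : 0 < M) (hlam : ∀ i, 0 < lam i) (hc : 0 < c)
    (h : OnCurve lam c z₀ u₀) (hz : 0 ≤ z₀.im) :
    ∃ v : ℂ → ℂ, AnalyticAt ℂ v z₀ ∧ v z₀ = u₀ ∧ ∀ᶠ z in 𝓝 z₀, OnCurve lam c z (v z) := by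
  obtain ⟨d, hd, hder⟩ := h.deriv_Z_ne_zero hM hlam hc hz
  have hu0 := ne_zero_of_im_pos h.im_pos
  have hu := fun i => one_add_mul_ne_zero h.im_pos (lam i)
  have han := analyticAt_Z (c := c) hu0 hu
  have hd' : deriv (Z lam c) u₀ ≠ 0 := by rwa [hder.hasDerivAt.deriv]
  have hv := han.analyticAt_localInverse hd'
  set v := han.hasStrictDerivAt.localInverse _ _ _ hd'
  have hv0 : v (Z lam c u₀) = u₀ := HasStrictFDerivAt.localInverse_apply_image ..
  have hright := han.hasStrictDerivAt.eventually_right_inverse hd'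
  rw [h.Z_eq] at hv hv0 hright
  refine ⟨v, hv, hv0, ?_⟩
  have hcont := hv.continuousAt
  have hGc : ContinuousAt (fun z => (-G lam (v z) / z).im) z₀ := by
    have : ContinuousAt (G lam) (v z₀) := by rw [hv0]; exact continuousAt_G hu
    refine Complex.continuous_im.continuousAt.comp (ContinuousAt.div ?_ continuousAt_id h.ne_zero)
    exact (ContinuousAt.comp this hcont).neg
  have e1 : ∀ᶠ z in 𝓝 z₀, 0 < (v z).im :=
    (Complex.continuous_im.continuousAt.comp hcont).eventually_const_lt
      (by simpa [hv0] using h.im_pos)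
  have e2 : ∀ᶠ z in 𝓝 z₀, 0 < (-G lam (v z) / z).im :=
    hGc.eventually_const_lt (by simpa only [hv0] using h.t_im_pos)
  filter_upwards [e1, e2, hright] with z h1 h2 h3
  exact ⟨h1, h3, h2⟩

/-! ### A priori bounds -/

/-- The contraction bound contains `B |u|² c ≤ 1`, and one term of the sum `B` gives `c λᵢ² |u|² ≤ M
|1 + u λᵢ|²`. This suffices when `|u| λᵢ ≥ 1/2`; otherwise `|1 + u λᵢ| ≥ 1/2` trivially. -/
lemma OnCurve.le_norm_one_add (hM : 0 < M) (hlam : ∀ i, 0 < lam i) (hc : 0 < c)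
    (h : OnCurve lam c z u) (hz : 0 ≤ z.im) (i : Fin M) :
    min (1 / 2) (√(c / (4 * M))) ≤ ‖1 + u * lam i‖ := by
  have hM' : (0 : ℝ) < M := by exact_mod_cast hM
  have hcon := (h.contraction hM hlam hc hz).1
  have hn := norm_pos_iff.2 (one_add_mul_ne_zero h.im_pos (lam i))
  have hl := hlam i
  rcases le_total (‖u‖ * lam i) (1 / 2) with hs | hs
  · refine (min_le_left _ _).trans ?_
    have h1 := norm_sub_le_norm_add (1 : ℂ) (u * lam i)
    rw [norm_one, norm_mul, Complex.norm_real, Real.norm_eq_abs, abs_of_pos hl] at h1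
    linarith
  · refine (min_le_right _ _).trans (Real.sqrt_le_iff.2 ⟨hn.le, ?_⟩)
    have hterm : lam i ^ 2 / ‖1 + u * lam i‖ ^ 2 ≤ M * B lam u := by
      have h1 : lam i ^ 2 / ‖1 + u * lam i‖ ^ 2 ≤ ∑ j, lam j ^ 2 / ‖1 + u * lam j‖ ^ 2 :=
        Finset.single_le_sum (f := fun j => lam j ^ 2 / ‖1 + u * lam j‖ ^ 2)
          (fun j _ => by positivity) (Finset.mem_univ i)
      rw [B]
      field_simp at h1 ⊢
      exact h1
    have h2 : B lam u * ‖u‖ ^ 2 * c ≤ 1 := by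
      refine le_trans ?_ hcon
      refine mul_le_mul_of_nonneg_left ?_ (mul_nonneg (B_nonneg _ _) (sq_nonneg _))
      have : 0 ≤ 1 / (c * ‖z‖ * ‖-G lam u / z‖ ^ 2) := by positivity
      linarith
    have h3 : lam i ^ 2 * ‖u‖ ^ 2 * c ≤ M * ‖1 + u * lam i‖ ^ 2 := by
      rw [div_le_iff₀ (by positivity)] at hterm
      calc lam i ^ 2 * ‖u‖ ^ 2 * c ≤ M * B lam u * ‖1 + u * lam i‖ ^ 2 * (‖u‖ ^ 2 * c) := by
            rw [mul_assoc]; gcongr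
        _ = M * ‖1 + u * lam i‖ ^ 2 * (B lam u * ‖u‖ ^ 2 * c) := by ring
        _ ≤ M * ‖1 + u * lam i‖ ^ 2 * 1 := by gcongr
        _ = _ := mul_one _
    rw [div_le_iff₀ (by positivity)]
    nlinarith [mul_self_nonneg (‖u‖ * lam i - 1 / 2)]

lemma eta_pos (hM : 0 < M) (hc : 0 < c) : 0 < min (1 / 2) (√(c / (4 * M))) := by
  have hM' : (0 : ℝ) < M := by exact_mod_cast hM
  exact lt_min (by norm_num) (Real.sqrt_pos.2 (by positivity))

/-- Since `z t = -G(u)`, this is the uniform bound `t = O(1/|z|)` needed for the integral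
representation and for dominated convergence in the inversion formula. -/
lemma OnCurve.exists_norm_G_le (hM : 0 < M) (hlam : ∀ i, 0 < lam i) (hc : 0 < c) :
    ∃ C : ℝ, 0 < C ∧ ∀ z u, 0 ≤ z.im → OnCurve lam c z u → ‖G lam u‖ ≤ C := by
  have : Nonempty (Fin M) := ⟨⟨0, hM⟩⟩
  have hM' : (0 : ℝ) < M := by exact_mod_cast hM
  have heta := eta_pos hM hc
  refine ⟨(1 / (M : ℝ)) * ∑ i, lam i / min (1 / 2) (√(c / (4 * M))), ?_, fun z u hz h => ?_⟩
  · exact mul_pos (by positivity)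
      (Finset.sum_pos (fun i _ => div_pos (hlam i) heta) Finset.univ_nonempty)
  · rw [G, norm_mul]
    have : ‖(1 / (M : ℂ))‖ = 1 / (M : ℝ) := by simp
    rw [this]
    refine mul_le_mul_of_nonneg_left ((norm_sum_le _ _).trans (Finset.sum_le_sum fun i _ => ?_))
      (by positivity)
    rw [norm_div, Complex.norm_real, Real.norm_eq_abs, abs_of_pos (hlam i)]
    have := hlam i
    have := h.le_norm_one_add hM hlam hc hz i
    gcongr

/-- Writing `u λ / (1 + u λ) = 1 - 1 / (1 + u λ)` makes the bound independent of the size of `u`. -/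
lemma norm_u_mul_G_le {η : ℝ} (hη : 0 < η) (hM : 0 < M) (hu : ∀ i, η ≤ ‖1 + u * lam i‖) :
    ‖u * G lam u‖ ≤ 1 + 1 / η := by
  have hM' : (0 : ℝ) < M := by exact_mod_cast hM
  have h1 : u * G lam u = (1 / (M : ℂ)) * ∑ i, (1 - 1 / (1 + u * lam i)) := by
    rw [G, mul_left_comm, Finset.mul_sum]
    congr 1
    refine Finset.sum_congr rfl fun i _ => ?_
    have : 1 + u * lam i ≠ 0 := norm_pos_iff.1 (hη.trans_le (hu i))
    field_simp
    ring
  rw [h1, norm_mul]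
  have : ‖(1 / (M : ℂ))‖ = 1 / (M : ℝ) := by simp
  rw [this]
  calc (1 / (M : ℝ)) * _ ≤ (1 / (M : ℝ)) * ∑ _i : Fin M, (1 + 1 / η) := by
        refine mul_le_mul_of_nonneg_left ((norm_sum_le _ _).trans (Finset.sum_le_sum fun i _ => ?_))
          (by positivity)
        refine (norm_sub_le _ _).trans ?_
        rw [norm_one, norm_div, norm_one]
        have := hu i
        gcongr
    _ = 1 + 1 / η := by
        rw [Finset.sum_const, Finset.card_univ, Fintype.card_fin, nsmul_eq_mul]
        field_simp

/-- For positive `λᵢ` and `c` the limit is nonzero, so `Z` has a simple pole at `0`. This bounds `u`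
from below, shows that `Z` is not constant, and gives the starting point of the existence proof. -/
lemma tendsto_Z_mul_self :
    Tendsto (fun u => Z lam c u * u) (𝓝[≠] 0) (𝓝 (-(c * G lam 0))) := by
  have hG : ContinuousAt (G lam) 0 := continuousAt_G (by simp)
  have h : ContinuousAt (fun u => -(c * G lam u * (1 - c * u * G lam u))) 0 := by fun_prop
  have h2 : Tendsto (fun u => -(c * G lam u * (1 - c * u * G lam u))) (𝓝[≠] 0)
      (𝓝 (-(c * G lam 0))) := by
    have := h.tendsto.mono_left (nhdsWithin_le_nhds (s := {0}ᶜ))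
    simpa using this
  refine h2.congr' ?_
  filter_upwards [self_mem_nhdsWithin] with u hu
  rw [Z, div_mul_cancel₀ _ hu]

lemma G_zero_pos (hM : 0 < M) (hlam : ∀ i, 0 < lam i) : ∃ g : ℝ, 0 < g ∧ G lam 0 = g := by
  have : Nonempty (Fin M) := ⟨⟨0, hM⟩⟩
  have hM' : (0 : ℝ) < M := by exact_mod_cast hM
  refine ⟨(1 / (M : ℝ)) * ∑ i, lam i, mul_pos (by positivity)
    (Finset.sum_pos (fun i _ => hlam i) Finset.univ_nonempty), ?_⟩
  simp [G]

/-- Near a point `z₀ ≠ 0`, the points of the curve stay in a compact set of regular points. -/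
lemma exists_isCompact (hM : 0 < M) (hlam : ∀ i, 0 < lam i) (hc : 0 < c) {z₀ : ℂ} (hz₀ : z₀ ≠ 0) :
    ∃ K : Set ℂ, IsCompact K ∧ (∀ u ∈ K, u ≠ 0 ∧ ∀ i, 1 + u * lam i ≠ 0) ∧
      ∀ᶠ z in 𝓝 z₀, ∀ u, 0 ≤ z.im → OnCurve lam c z u → u ∈ K := by
  obtain ⟨g, hg, hG⟩ := G_zero_pos hM hlam
  have heta := eta_pos hM hc
  set η := min (1 / 2) (√(c / (4 * M)))
  have hlow : ∀ᶠ u in 𝓝[≠] (0 : ℂ), c * g / 2 < ‖Z lam c u * u‖ := by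
    refine (tendsto_Z_mul_self.norm).eventually_const_lt ?_
    rw [hG, norm_neg, norm_mul, Complex.norm_real, Complex.norm_real, Real.norm_eq_abs,
      Real.norm_eq_abs, abs_of_pos hc, abs_of_pos hg]
    have := mul_pos hc hg
    linarith
  obtain ⟨δ, hδ, hball⟩ := Metric.mem_nhdsWithin_iff.1 hlow
  set r := ‖z₀‖
  have hr : 0 < r := norm_pos_iff.2 hz₀
  -- The identity `z u² = -c (uG) (1 - c uG)` bounds `|z| |u|²` by `r ρ / 2`, while `|z| > r / 2`;
  -- the radius `max 1 ρ` is used so that `|u| > max 1 ρ` implies `|u|² > ρ`. Below, `d` is small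
  -- enough that `|u| < d` and `|z| < 2r` force `|z u| < c g / 2`, against the behaviour at the
  -- pole.
  set ρ := 2 * (c * (1 + 1 / η) * (1 + c * (1 + 1 / η))) / r
  set d := min δ (c * g / (4 * r))
  have hd : 0 < d := lt_min hδ (by positivity)
  refine ⟨Metric.closedBall 0 (max 1 ρ) ∩ ({u | d ≤ ‖u‖} ∩ ⋂ i, {u | η ≤ ‖1 + u * lam i‖}), ?_, ?_, ?_⟩
  · refine (isCompact_closedBall _ _).inter_right (IsClosed.inter ?_ (isClosed_iInter fun i => ?_))
    · exact isClosed_le continuous_const continuous_norm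
    · exact isClosed_le continuous_const (by fun_prop)
  · rintro u ⟨-, hu1, hu2⟩
    refine ⟨norm_pos_iff.1 (hd.trans_le hu1), fun i => ?_⟩
    have := mem_iInter.1 hu2 i
    exact norm_pos_iff.1 (heta.trans_le this)
  · have e1 : ∀ᶠ z in 𝓝 z₀, r / 2 < ‖z‖ :=
      continuous_norm.continuousAt.eventually_const_lt (by linarith)
    have e2 : ∀ᶠ z in 𝓝 z₀, ‖z‖ < 2 * r :=
      continuous_norm.continuousAt.eventually_lt_const (by linarith)
    filter_upwards [e1, e2] with z h1 h2 u hz h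
    have heu := h.le_norm_one_add hM hlam hc hz
    have hu0 := ne_zero_of_im_pos h.im_pos
    have hu := norm_pos_iff.2 hu0
    refine ⟨?_, ?_, mem_iInter.2 heu⟩
    · rw [mem_closedBall_zero_iff]
      by_contra! hlt
      obtain ⟨h3, h4⟩ := max_lt_iff.1 hlt
      have h5 : z * u ^ 2 = -(c * (u * G lam u) * (1 - c * (u * G lam u))) := by
        rw [← h.Z_eq, Z]
        field_simp
      have h6 := congrArg norm h5
      rw [norm_mul, norm_pow, norm_neg, norm_mul, norm_mul, Complex.norm_real, Real.norm_eq_abs,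
        abs_of_pos hc] at h6
      have h7 := norm_u_mul_G_le heta hM heu
      have h8 : ‖(1 - c * (u * G lam u) : ℂ)‖ ≤ 1 + c * (1 + 1 / η) := by
        refine (norm_sub_le _ _).trans ?_
        rw [norm_one, norm_mul, Complex.norm_real, Real.norm_eq_abs, abs_of_pos hc]
        gcongr
      have h9 : ‖z‖ * ‖u‖ ^ 2 ≤ c * (1 + 1 / η) * (1 + c * (1 + 1 / η)) := by
        rw [h6]; gcongr
      have h10 : r / 2 * ρ < ‖z‖ * ‖u‖ ^ 2 := by
        have : ρ < ‖u‖ ^ 2 := by nlinarith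
        have hρ : 0 ≤ ρ := by positivity
        calc r / 2 * ρ ≤ ‖z‖ * ρ := by gcongr
          _ < ‖z‖ * ‖u‖ ^ 2 := by
            have : 0 < ‖z‖ := norm_pos_iff.2 h.ne_zero
            gcongr
      have h11 : r / 2 * ρ = c * (1 + 1 / η) * (1 + c * (1 + 1 / η)) := by
        simp only [ρ]; field_simp
      linarith
    · by_contra! hlt
      rw [mem_ofPred_eq, not_le] at hlt
      obtain ⟨h3, h4⟩ := lt_min_iff.1 hlt
      have h5 := hball ⟨mem_ball_zero_iff.2 h3, hu0⟩
      simp only [mem_ofPred_eq, h.Z_eq, norm_mul] at h5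
      rw [lt_div_iff₀ (by positivity)] at h4
      nlinarith

/-! ### Existence -/

/-- A limit of points of the curve lying above an interior point is a point of the curve. -/
lemma onCurve_of_limit (hM : 0 < M) (hlam : ∀ i, 0 < lam i) (hc : 0 < c) {z₀ u₀ : ℂ}
    (hz : 0 < z₀.im) (hu0 : u₀ ≠ 0) (hu : ∀ i, 1 + u₀ * lam i ≠ 0) 
    (hZ : Z lam c u₀ = z₀) (him : 0 ≤ u₀.im) (hzu : 0 ≤ (z₀ * u₀).im) : OnCurve lam c z₀ u₀ := by
  have hz0 := ne_zero_of_im_pos hz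
  have hG : G lam u₀ ≠ 0 := by
    intro h
    rw [Z, h] at hZ
    simp [hz0.symm] at hZ
  -- The term `D Im z` restores a strict sign in the limit; strict positivity of `Im u₀` is then
  -- recovered from that of `Im t`.
  have ht : 0 < (-G lam u₀ / z₀).im := by
    rw [t_im_eq]
    have := D_pos hM hlam hu
    have := B_nonneg lam u₀
    have := norm_pos_iff.2 hz0
    positivity
  refine ⟨?_, hZ, ht⟩
  have hinv := inv_eq_of_Z_eq hc hu0 hG hz0 hZ
  rw [(im_formulas hz0 hinv).1]
  have h1 : 0 ≤ (z₀ * (-G lam u₀ / z₀)).im := by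
    rw [mul_t hz0, Complex.neg_im, G_im_eq, neg_neg]
    exact mul_nonneg (B_nonneg _ _) him
  have := norm_pos_iff.2 hu0
  have := norm_pos_iff.2 (ne_zero_of_im_pos ht)
  positivity

end
end CanonicalCurve

namespace CanonicalCurve

variable {M : ℕ} {lam : Fin M → ℝ} {c : ℝ}

lemma isPreconnected_upperHalf : IsPreconnected {z : ℂ | 0 < z.im} :=
  (convex_halfSpace_im_gt 0).isPreconnected

lemma isOpen_upperHalf : IsOpen {z : ℂ | 0 < z.im} :=
  isOpen_lt continuous_const Complex.continuous_im

/-- For `u = i e` with small `e > 0`, the pole gives `z ≈ i c g / e`, and `t = -G(u)/z ≈ i e / c`;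
both lie in the upper half-plane. -/
lemma exists_onCurve_somewhere (hM : 0 < M) (hlam : ∀ i, 0 < lam i) (hc : 0 < c) :
    ∃ z u, 0 < z.im ∧ OnCurve lam c z u := by
  obtain ⟨g, hg, hG0⟩ := G_zero_pos hM hlam
  have hline : Tendsto (fun e : ℝ => (e : ℂ) * Complex.I) (𝓝[>] 0) (𝓝[≠] 0) := by
    refine tendsto_nhdsWithin_iff.2 ⟨?_, ?_⟩
    · have : Continuous fun e : ℝ => (e : ℂ) * Complex.I := by fun_prop
      simpa using (this.tendsto 0).mono_left nhdsWithin_le_nhds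
    · filter_upwards [self_mem_nhdsWithin] with e he
      simpa using he.ne'
  have h1 := ((tendsto_Z_mul_self (lam := lam) (c := c)).comp hline)
  have hGc : Tendsto (G lam) (𝓝[≠] 0) (𝓝 (G lam 0)) :=
    (continuousAt_G (by simp)).tendsto.mono_left nhdsWithin_le_nhds
  have h2 := hGc.comp hline
  rw [hG0] at h1 h2
  have h3 : ∀ᶠ e : ℝ in 𝓝[>] 0, (Z lam c (e * Complex.I) * (e * Complex.I)).re < 0 :=
    (Complex.continuous_re.continuousAt.tendsto.comp h1).eventually_lt_const
      (by simp; positivity)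
  have hZne : -(c * (g : ℂ)) ≠ 0 := by
    have : (c : ℂ) ≠ 0 := by exact_mod_cast hc.ne'
    have : (g : ℂ) ≠ 0 := by exact_mod_cast hg.ne'
    simp [*]
  have h5 := (h2.neg.div h1 hZne)
  have h6 : ∀ᶠ e : ℝ in 𝓝[>] 0,
      0 < (-G lam (e * Complex.I) / (Z lam c (e * Complex.I) * (e * Complex.I))).re := by
    refine (Complex.continuous_re.continuousAt.tendsto.comp h5).eventually_const_lt ?_
    have : -(g : ℂ) / -(c * g) = ((1 / c : ℝ) : ℂ) := by
      have : (c : ℂ) ≠ 0 := by exact_mod_cast hc.ne'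
      have : (g : ℂ) ≠ 0 := by exact_mod_cast hg.ne'
      push_cast
      field_simp
    rw [this, Complex.ofReal_re]
    positivity
  obtain ⟨e, he3, he6, he⟩ := (h3.and (h6.and self_mem_nhdsWithin)).exists
  have he : 0 < e := he
  have him : (Z lam c (e * Complex.I) * (e * Complex.I)).re =
      -e * (Z lam c (e * Complex.I)).im := by simp; ring
  have hquot : -G lam (e * Complex.I) / Z lam c (e * Complex.I) =
      e * (Complex.I * (-G lam (e * Complex.I) / (Z lam c (e * Complex.I) * (e * Complex.I)))) := by
    have : (e : ℂ) ≠ 0 := by exact_mod_cast he.ne'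
    by_cases hz : Z lam c (e * Complex.I) = 0
    · simp [hz]
    field_simp [Complex.I_ne_zero]
  refine ⟨Z lam c (e * Complex.I), e * Complex.I, ?_, ⟨by simpa using he, rfl, ?_⟩⟩
  · rw [him] at he3
    nlinarith
  · rw [hquot, Complex.im_ofReal_mul, Complex.I_mul_im]
    positivity

theorem exists_onCurve (hM : 0 < M) (hlam : ∀ i, 0 < lam i) (hc : 0 < c) {z : ℂ} (hz : 0 < z.im) :
    ∃ u, OnCurve lam c z u := by
  set S : Set ℂ := {z | 0 < z.im ∧ ∃ u, OnCurve lam c z u}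
  have hopen : IsOpen S := by
    rw [isOpen_iff_mem_nhds]
    rintro z₀ ⟨hz₀, u₀, h₀⟩
    obtain ⟨v, -, -, hv⟩ := h₀.exists_local_inverse hM hlam hc hz₀.le
    filter_upwards [hv, isOpen_upperHalf.mem_nhds hz₀] with z h1 h2
    exact ⟨h2, _, h1⟩
  have hne : ({z : ℂ | 0 < z.im} ∩ S).Nonempty := by
    obtain ⟨z, u, h1, h2⟩ := exists_onCurve_somewhere hM hlam hc
    exact ⟨z, h1, h1, u, h2⟩
  have hclosed : closure S ∩ {z : ℂ | 0 < z.im} ⊆ S := by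
    rintro z₀ ⟨hcl, hz₀⟩
    have hz₀ : 0 < z₀.im := hz₀
    obtain ⟨x, hxS, hx⟩ := mem_closure_iff_seq_limit.1 hcl
    choose hxim w hw using hxS
    obtain ⟨K, hK, hreg, hev⟩ := exists_isCompact hM hlam hc (ne_zero_of_im_pos hz₀)
    have hwK : ∀ᶠ n in atTop, w n ∈ K := by
      filter_upwards [hx.eventually hev] with n hn
      exact hn _ (hxim n).le (hw n)
    obtain ⟨u₀, hu₀K, φ, hφ, hlim⟩ := hK.tendsto_subseq' hwK.frequently
    obtain ⟨hu0, hu⟩ := hreg u₀ hu₀K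
    have hxφ := hx.comp hφ.tendsto_atTop
    refine ⟨hz₀, u₀, onCurve_of_limit hM hlam hc hz₀ hu0 hu ?_ ?_ ?_⟩
    · have h1 := (continuousAt_Z (c := c) hu0 hu).tendsto.comp hlim
      have h2 : (Z lam c ∘ w ∘ φ) = x ∘ φ := by
        funext n; exact (hw (φ n)).Z_eq
      rw [h2] at h1
      exact tendsto_nhds_unique h1 hxφ
    · refine ge_of_tendsto' (Complex.continuous_im.continuousAt.tendsto.comp hlim) fun n => ?_
      exact (hw (φ n)).im_pos.le
    · refine ge_of_tendsto' (Complex.continuous_im.continuousAt.tendsto.comp (hxφ.mul hlim))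
        fun n => ?_
      exact ((hw (φ n)).zu_im_pos hM hlam hc).le
  -- `S` is nonempty, open and relatively closed in the connected half-plane.
  exact (isPreconnected_upperHalf.subset_of_closure_inter_subset hopen hne hclosed hz).2

open Classical in
/-- The point of the curve above `z`. -/
def uOf (lam : Fin M → ℝ) (c : ℝ) (z : ℂ) : ℂ :=
  if h : ∃ u, OnCurve lam c z u then h.choose else 0

lemma onCurve_uOf (hM : 0 < M) (hlam : ∀ i, 0 < lam i) (hc : 0 < c) {z : ℂ} (hz : 0 < z.im) :
    OnCurve lam c z (uOf lam c z) := by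
  have h := exists_onCurve hM hlam hc hz
  rw [uOf, dif_pos h]
  exact h.choose_spec

lemma OnCurve.eq_uOf {z u : ℂ} (hM : 0 < M) (hlam : ∀ i, 0 < lam i) (hc : 0 < c) (hz : 0 < z.im)
    (h : OnCurve lam c z u) : u = uOf lam c z :=
  h.unique hM hlam hc hz (onCurve_uOf hM hlam hc hz)

lemma analyticAt_uOf (hM : 0 < M) (hlam : ∀ i, 0 < lam i) (hc : 0 < c) {z : ℂ} (hz : 0 < z.im) :
    AnalyticAt ℂ (uOf lam c) z := by
  obtain ⟨v, hv, -, hev⟩ := (onCurve_uOf hM hlam hc hz).exists_local_inverse hM hlam hc hz.le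
  refine hv.congr ?_
  filter_upwards [hev, isOpen_upperHalf.mem_nhds hz] with w h1 h2
  exact h1.eq_uOf hM hlam hc h2

/-! ### Boundary values -/

lemma isPreconnected_regular : IsPreconnected {u : ℂ | u ≠ 0 ∧ ∀ i, 1 + u * lam i ≠ 0} := by
  have hfin : ({u : ℂ | u ≠ 0 ∧ ∀ i, 1 + u * lam i ≠ 0}ᶜ).Countable := by
    have : {u : ℂ | u ≠ 0 ∧ ∀ i, 1 + u * lam i ≠ 0}ᶜ ⊆
        insert 0 (range fun i => -(1 / (lam i : ℂ))) := by
      intro u hu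
      by_contra hu'
      simp only [mem_insert_iff, mem_range, not_or, not_exists] at hu'
      refine hu ⟨hu'.1, fun i h => hu'.2 i ?_⟩
      have hl : (lam i : ℂ) ≠ 0 := by
        intro h0; simp [h0] at h
      field_simp
      linear_combination -h
    exact ((countable_range _).insert 0).mono this
  have := hfin.isConnected_compl_of_one_lt_rank (by simp)
  rw [compl_compl] at this
  exact this.isPreconnected

/-- Otherwise the identity theorem makes `Z` constant on the connected set of regular points, and
then `u Z(u)` tends to `0` instead of `-c G(0)` at the origin. -/
lemma eventually_Z_ne (hM : 0 < M) (hlam : ∀ i, 0 < lam i) (hc : 0 < c) {z₀ p : ℂ}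
    (hp0 : p ≠ 0) (hp : ∀ i, 1 + p * lam i ≠ 0) :
    ∀ᶠ u in 𝓝[≠] p, Z lam c u ≠ z₀ := by
  rcases (analyticAt_Z (c := c) hp0 hp).eventually_eq_or_eventually_ne
    (analyticAt_const (v := z₀)) with h | h
  · exfalso
    have heq : EqOn (Z lam c) (fun _ => z₀) {u : ℂ | u ≠ 0 ∧ ∀ i, 1 + u * lam i ≠ 0} :=
      AnalyticOnNhd.eqOn_of_preconnected_of_eventuallyEq
        (fun u hu => analyticAt_Z hu.1 hu.2) (fun u _ => analyticAt_const)
        isPreconnected_regular ⟨hp0, hp⟩ h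
    obtain ⟨g, hg, hG⟩ := G_zero_pos hM hlam
    have h1 := tendsto_Z_mul_self (lam := lam) (c := c)
    have hreg : ∀ᶠ u : ℂ in 𝓝[≠] 0, ∀ i, 1 + u * lam i ≠ 0 := by
      refine eventually_nhdsWithin_of_eventually_nhds (eventually_all.2 fun i => ?_)
      exact ContinuousAt.eventually_ne (g := fun v : ℂ => 1 + v * lam i) (by fun_prop) (by simp)
    have h2 : Tendsto (fun u => Z lam c u * u) (𝓝[≠] 0) (𝓝 (z₀ * 0)) := by
      have : Tendsto (fun u : ℂ => z₀ * u) (𝓝[≠] 0) (𝓝 (z₀ * 0)) :=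
        (continuous_const.mul continuous_id).continuousAt.tendsto.mono_left nhdsWithin_le_nhds
      refine this.congr' ?_
      filter_upwards [hreg, self_mem_nhdsWithin] with u h3 h4
      rw [heq ⟨h4, h3⟩]
    have h3 := tendsto_nhds_unique h1 h2
    rw [hG] at h3
    have : (c : ℂ) ≠ 0 := by exact_mod_cast hc.ne'
    have : (g : ℂ) ≠ 0 := by exact_mod_cast hg.ne'
    simp [*] at h3
  · exact h

/-- The parametrization has a limit at every nonzero real point. -/
theorem exists_tendsto_uOf (hM : 0 < M) (hlam : ∀ i, 0 < lam i) (hc : 0 < c) {x : ℝ} (hx : x ≠ 0) :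
    ∃ p : ℂ, p ≠ 0 ∧ (∀ i, 1 + p * lam i ≠ 0) ∧ Z lam c p = x ∧
      Tendsto (uOf lam c) (𝓝[{z : ℂ | 0 < z.im}] (x : ℂ)) (𝓝 p) := by
  have hx0 : (x : ℂ) ≠ 0 := by exact_mod_cast hx
  obtain ⟨K, hK, hreg, hev⟩ := exists_isCompact hM hlam hc hx0
  have hKev : ∀ᶠ z in 𝓝[{z : ℂ | 0 < z.im}] (x : ℂ), uOf lam c z ∈ K := by
    filter_upwards [eventually_nhdsWithin_of_eventually_nhds hev, self_mem_nhdsWithin] with z h1 h2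
    exact h1 _ (le_of_lt h2) (onCurve_uOf hM hlam hc h2)
  have hcl : (x : ℂ) ∈ closure {z : ℂ | 0 < z.im} := by
    rw [Complex.closure_setOfPred_lt_im]; simp
  have : (𝓝[{z : ℂ | 0 < z.im}] (x : ℂ)).NeBot := mem_closure_iff_nhdsWithin_neBot.1 hcl
  obtain ⟨p, hpK, hp⟩ := hK.exists_mapClusterPt (tendsto_principal.2 hKev)
  obtain ⟨hp0, hpr⟩ := hreg p hpK
  have hZtend : Tendsto (fun z => Z lam c (uOf lam c z)) (𝓝[{z : ℂ | 0 < z.im}] (x : ℂ)) (𝓝 (x : ℂ)) := by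
    refine (tendsto_id.mono_left nhdsWithin_le_nhds).congr' ?_
    filter_upwards [self_mem_nhdsWithin] with z hz
    exact ((onCurve_uOf hM hlam hc hz).Z_eq).symm
  have hZp : Z lam c p = x := by
    have h1 : MapClusterPt (Z lam c p) (𝓝[{z : ℂ | 0 < z.im}] (x : ℂ)) (Z lam c ∘ uOf lam c) :=
      hp.continuousAt_comp (continuousAt_Z hp0 hpr)
    have := h1.clusterPt.mono hZtend
    exact eq_of_nhds_neBot (this)
  refine ⟨p, hp0, hpr, hZp, ?_⟩
  rw [Metric.tendsto_nhds]
  intro ε hε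
  obtain ⟨ρ₀, hρ₀, hball⟩ := Metric.mem_nhdsWithin_iff.1
    (eventually_Z_ne hM hlam hc hp0 hpr (z₀ := (x : ℂ)))
  -- On a circle this small around the cluster point, `Z` omits the value `x`. By compactness `Z`
  -- stays away from `x` on the part of the circle in `K`, so for `z` near `x` the point `u(z)` is
  -- never on the circle.
  set ρ := min ε ρ₀ / 2
  have hmin : 0 < min ε ρ₀ := lt_min hε hρ₀
  have hρ : 0 < ρ := by positivity
  have hρε : ρ < ε := (half_lt_self hmin).trans_le (min_le_left _ _)
  have hρρ₀ : ρ < ρ₀ := (half_lt_self hmin).trans_le (min_le_right _ _)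
  have hS : IsClosed (Z lam c '' (Metric.sphere p ρ ∩ K)) := by
    refine (((hK.inter_left Metric.isClosed_sphere)).image_of_continuousOn fun u hu => ?_).isClosed
    exact (continuousAt_Z (hreg u hu.2).1 (hreg u hu.2).2).continuousWithinAt
  have hxS : (x : ℂ) ∉ Z lam c '' (Metric.sphere p ρ ∩ K) := by
    rintro ⟨u, ⟨hu, -⟩, hux⟩
    rw [Metric.mem_sphere] at hu
    refine hball ⟨by rw [Metric.mem_ball, hu]; exact hρρ₀, ?_⟩ hux
    rintro rfl
    rw [dist_self] at hu
    exact hρ.ne hu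
  have hev2 : ∀ᶠ z in 𝓝[{z : ℂ | 0 < z.im}] (x : ℂ), uOf lam c z ∉ Metric.sphere p ρ := by
    filter_upwards [eventually_nhdsWithin_of_eventually_nhds (hS.isOpen_compl.mem_nhds hxS), hKev,
      self_mem_nhdsWithin] with z h1 h2 h3 h4
    exact h1 ⟨_, ⟨h4, h2⟩, (onCurve_uOf hM hlam hc h3).Z_eq⟩
  obtain ⟨δ, hδ, hδS⟩ := Metric.mem_nhdsWithin_iff.1 hev2
  set W := Metric.ball (x : ℂ) δ ∩ {z : ℂ | 0 < z.im}
  have hW : IsPreconnected W :=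
    ((convex_ball _ _).inter (convex_halfSpace_im_gt 0)).isPreconnected
  have hWmem : W ∈ 𝓝[{z : ℂ | 0 < z.im}] (x : ℂ) :=
    Metric.mem_nhdsWithin_iff.2 ⟨δ, hδ, subset_rfl⟩
  -- The image of a half-disc is connected, avoids the circle and meets the open disc because `p` is
  -- a cluster point; hence it lies in the disc.
  have himg : IsPreconnected (uOf lam c '' W) := hW.image _ fun z hz =>
    (analyticAt_uOf hM hlam hc hz.2).continuousAt.continuousWithinAt
  obtain ⟨z₁, hz₁, hz₁W⟩ := ((hp.frequently (Metric.ball_mem_nhds p hρ)).and_eventually hWmem).exists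
  have hsub : uOf lam c '' W ⊆ Metric.ball p ρ := by
    refine himg.subset_left_of_subset_union Metric.isOpen_ball
      (Metric.isClosed_closedBall (x := p) (ε := ρ)).isOpen_compl ?_ ?_ ⟨_, ⟨z₁, hz₁W, rfl⟩, hz₁⟩
    · exact disjoint_left.2 fun u h1 h2 => h2 (Metric.ball_subset_closedBall h1)
    · rintro _ ⟨z, hz, rfl⟩
      have h1 : dist (uOf lam c z) p ≠ ρ := hδS hz
      rcases h1.lt_or_gt with h | h
      · exact Or.inl h
      · exact Or.inr fun h2 => absurd (Metric.mem_closedBall.1 h2) (not_le.2 h)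
  filter_upwards [hWmem] with z hz
  exact (Metric.mem_ball.1 (hsub ⟨z, hz, rfl⟩)).trans hρε

end CanonicalCurve

/-! ### Inversion of the Stieltjes transform -/

namespace StieltjesInversion

variable {μ : Measure ℝ}

lemma resolvent_eq (z : ℂ) (l : ℝ) : resolvent z l = ((l : ℂ) - z)⁻¹ := by
  rw [resolvent, Ring.inverse_eq_inv']
  rfl

lemma im_resolvent (x y l : ℝ) :
    (resolvent ((x : ℂ) + y * Complex.I) l).im = y / ((l - x) ^ 2 + y ^ 2) := by
  rw [resolvent_eq, Complex.inv_im]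
  simp [Complex.normSq_apply]
  ring

lemma norm_resolvent_le {z : ℂ} (hz : 0 < z.im) (l : ℝ) : ‖resolvent z l‖ ≤ 1 / z.im := by
  rw [resolvent_eq, norm_inv, one_div]
  refine inv_anti₀ hz ?_
  have h := Complex.abs_im_le_norm ((l : ℂ) - z)
  rw [Complex.sub_im, Complex.ofReal_im, zero_sub, abs_neg, abs_of_pos hz] at h
  exact h

lemma integrable_resolvent [IsFiniteMeasure μ] {z : ℂ} (hz : 0 < z.im) :
    Integrable (fun l : ℝ => resolvent z l) μ :=
  Integrable.of_bound (by fun_prop) (1 / z.im) (ae_of_all _ fun l => norm_resolvent_le hz l)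

lemma im_resolventTransform [IsFiniteMeasure μ] (x : ℝ) {y : ℝ} (hy : 0 < y) :
    (resolventTransform μ ((x : ℂ) + y * Complex.I)).im = ∫ l, y / ((l - x) ^ 2 + y ^ 2) ∂μ := by
  have hz : 0 < ((x : ℂ) + y * Complex.I).im := by simpa using hy
  rw [resolventTransform_apply]
  have := (Complex.imCLM.integral_comp_comm (integrable_resolvent (μ := μ) hz)).symm
  simp only [Complex.imCLM_apply, im_resolvent] at this
  exact this

lemma poisson_le {y : ℝ} (hy : 0 < y) (x l : ℝ) : ‖y / ((l - x) ^ 2 + y ^ 2)‖ ≤ 1 / y := by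
  rw [Real.norm_eq_abs, abs_of_nonneg (by positivity), div_le_div_iff₀ (by positivity) hy]
  nlinarith [sq_nonneg (l - x)]

lemma integral_poisson {y : ℝ} (hy : 0 < y) (a b l : ℝ) :
    ∫ x in a..b, y / ((l - x) ^ 2 + y ^ 2) = Real.arctan ((b - l) / y) - Real.arctan ((a - l) / y) := by
  refine intervalIntegral.integral_eq_sub_of_hasDerivAt
    (f := fun x => Real.arctan ((x - l) / y)) (fun x _ => ?_) ?_
  · have h1 : HasDerivAt (fun x => (x - l) / y) (1 / y) x :=
      ((hasDerivAt_id x).sub_const l).div_const y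
    convert! h1.arctan using 1
    field_simp
    ring
  · refine Continuous.intervalIntegrable ?_ _ _
    refine continuous_const.div (by fun_prop) fun x => ?_
    positivity

lemma integral_im_resolventTransform [IsFiniteMeasure μ] {a b y : ℝ} (hab : a ≤ b) (hy : 0 < y) :
    ∫ x in a..b, (resolventTransform μ ((x : ℂ) + y * Complex.I)).im =
      ∫ l, (Real.arctan ((b - l) / y) - Real.arctan ((a - l) / y)) ∂μ := by
  simp_rw [im_resolventTransform _ hy, ← integral_poisson hy]
  simp_rw [intervalIntegral.integral_of_le hab]
  refine integral_integral_swap ?_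
  refine Integrable.of_bound (C := 1 / y) ?_ (ae_of_all _ fun p => poisson_le hy p.1 p.2)
  refine Continuous.aestronglyMeasurable ?_
  refine continuous_const.div (by fun_prop) fun x => ?_
  positivity

lemma tendsto_arctan_div (t : ℝ) :
    Tendsto (fun y : ℝ => Real.arctan (t / y)) (𝓝[>] 0) (𝓝 (Real.pi / 2 * SignType.sign t)) := by
  rcases lt_trichotomy t 0 with ht | rfl | ht
  · have h : Tendsto (fun y : ℝ => t / y) (𝓝[>] 0) atBot := by
      simp_rw [div_eq_mul_inv]
      exact tendsto_inv_nhdsGT_zero.const_mul_atTop_of_neg ht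
    have := (tendsto_nhds_of_tendsto_nhdsWithin Real.tendsto_arctan_atBot).comp h
    simpa [sign_neg ht, Function.comp_def] using this
  · simp
  · have h : Tendsto (fun y : ℝ => t / y) (𝓝[>] 0) atTop := by
      simp_rw [div_eq_mul_inv]
      exact tendsto_inv_nhdsGT_zero.const_mul_atTop ht
    have := (tendsto_nhds_of_tendsto_nhdsWithin Real.tendsto_arctan_atTop).comp h
    simpa [sign_pos ht, Function.comp_def] using this

/-- By Fubini the integral is that of a difference of arctangents, which is bounded by `π` and tends
to `π` inside the interval, `π/2` at the endpoints and `0` outside. -/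
theorem tendsto_integral_im [IsFiniteMeasure μ] {a b : ℝ} (hab : a < b) :
    Tendsto (fun y : ℝ => ∫ x in a..b, (resolventTransform μ ((x : ℂ) + y * Complex.I)).im)
      (𝓝[>] 0) (𝓝 (Real.pi * (μ.real (Ioo a b) + (μ.real {a} + μ.real {b}) / 2))) := by
  have hlim : Tendsto (fun y : ℝ => ∫ l, (Real.arctan ((b - l) / y) - Real.arctan ((a - l) / y)) ∂μ)
      (𝓝[>] 0) (𝓝 (∫ l, (Real.pi / 2 * SignType.sign (b - l) -
        Real.pi / 2 * SignType.sign (a - l)) ∂μ)) := by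
    refine tendsto_integral_filter_of_dominated_convergence (fun _ => Real.pi) ?_ ?_
      (integrable_const _) ?_
    · refine Eventually.of_forall fun y => Measurable.aestronglyMeasurable ?_
      exact (Real.measurable_arctan.comp (by fun_prop)).sub (Real.measurable_arctan.comp (by fun_prop))
    · refine Eventually.of_forall fun y => ae_of_all _ fun l => ?_
      rw [Real.norm_eq_abs, abs_le]
      constructor <;>
      linarith [Real.arctan_lt_pi_div_two ((b - l) / y), Real.neg_pi_div_two_lt_arctan ((b - l) / y),
        Real.arctan_lt_pi_div_two ((a - l) / y), Real.neg_pi_div_two_lt_arctan ((a - l) / y)]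
    · exact ae_of_all _ fun l => (tendsto_arctan_div _).sub (tendsto_arctan_div _)
  have hval : ∫ l, (Real.pi / 2 * SignType.sign (b - l) - Real.pi / 2 * SignType.sign (a - l)) ∂μ =
      Real.pi * (μ.real (Ioo a b) + (μ.real {a} + μ.real {b}) / 2) := by
    have hfun : (fun l => (Real.pi / 2 * SignType.sign (b - l) -
        Real.pi / 2 * SignType.sign (a - l) : ℝ)) = fun l =>
        (Ioo a b).indicator (fun _ => Real.pi) l + (({a} : Set ℝ).indicator (fun _ => Real.pi / 2) l +
          ({b} : Set ℝ).indicator (fun _ => Real.pi / 2) l) := by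
      funext l
      rcases lt_trichotomy l a with h1 | rfl | h1
      · have h2 : l < b := h1.trans hab
        simp [sign_pos (sub_pos.2 h1), sign_pos (sub_pos.2 h2), h1.ne, h2.ne, not_lt.2 h1.le]
      · simp [sign_pos (sub_pos.2 hab), hab.ne]
      · rcases lt_trichotomy l b with h2 | rfl | h2
        · simp [sign_neg (sub_neg.2 h1), sign_pos (sub_pos.2 h2), h1.ne', h2.ne, h1, h2]
        · simp [sign_neg (sub_neg.2 h1), h1.ne']
        · simp [sign_neg (sub_neg.2 h1), sign_neg (sub_neg.2 h2), h1.ne', h2.ne', h1, not_lt.2 h2.le]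
    rw [hfun, integral_add, integral_add, integral_indicator_const _ measurableSet_Ioo,
      integral_indicator_const _ (measurableSet_singleton a),
      integral_indicator_const _ (measurableSet_singleton b)]
    · simp only [smul_eq_mul]; ring
    · exact (integrable_const _).indicator (measurableSet_singleton a)
    · exact (integrable_const _).indicator (measurableSet_singleton b)
    · exact (integrable_const _).indicator measurableSet_Ioo
    · exact ((integrable_const _).indicator (measurableSet_singleton a)).add
        ((integrable_const _).indicator (measurableSet_singleton b))
  rw [← hval]
  refine hlim.congr' ?_
  filter_upwards [self_mem_nhdsWithin] with y hy
  rw [integral_im_resolventTransform hab.le hy]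

section density

variable [IsFiniteMeasure μ] {A B C : ℝ} {g : ℝ → ℝ}

lemma integral_boundary
    (hbound : ∀ x ∈ Ioo A B, ∀ y : ℝ, 0 < y →
      |(resolventTransform μ ((x : ℂ) + y * Complex.I)).im| ≤ C)
    (hlim : ∀ x ∈ Ioo A B, Tendsto (fun y : ℝ =>
      (resolventTransform μ ((x : ℂ) + y * Complex.I)).im) (𝓝[>] 0) (𝓝 (g x)))
    {a b : ℝ} (ha : A < a) (hab : a < b) (hb : b < B) :
    ∫ x in a..b, g x = Real.pi * (μ.real (Ioo a b) + (μ.real {a} + μ.real {b}) / 2) := by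
  refine tendsto_nhds_unique ?_ (tendsto_integral_im (μ := μ) hab)
  have hsub : ∀ x ∈ uIoc a b, x ∈ Ioo A B := by
    intro x hx
    rw [uIoc_of_le hab.le] at hx
    exact ⟨ha.trans hx.1, hx.2.trans_lt hb⟩
  refine intervalIntegral.tendsto_integral_filter_of_dominated_convergence (fun _ => C) ?_ ?_
    intervalIntegrable_const ?_
  · filter_upwards [self_mem_nhdsWithin] with y hy
    simp_rw [im_resolventTransform _ hy]
    refine AEStronglyMeasurable.integral_prod_right' (f := fun p : ℝ × ℝ =>
      y / ((p.2 - p.1) ^ 2 + y ^ 2)) ?_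
    refine Continuous.aestronglyMeasurable ?_
    refine continuous_const.div (by fun_prop) fun x => ?_
    have : 0 < y := hy
    positivity
  · filter_upwards [self_mem_nhdsWithin] with y hy
    exact ae_of_all _ fun x hx => hbound x (hsub x hx) y hy
  · exact ae_of_all _ fun x hx => hlim x (hsub x hx)

lemma boundary_mem_Icc
    (hbound : ∀ x ∈ Ioo A B, ∀ y : ℝ, 0 < y →
      |(resolventTransform μ ((x : ℂ) + y * Complex.I)).im| ≤ C)
    (hlim : ∀ x ∈ Ioo A B, Tendsto (fun y : ℝ =>
      (resolventTransform μ ((x : ℂ) + y * Complex.I)).im) (𝓝[>] 0) (𝓝 (g x)))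
    {x : ℝ} (hx : x ∈ Ioo A B) : g x ∈ Icc 0 C := by
  constructor
  · refine ge_of_tendsto (hlim x hx) ?_
    filter_upwards [self_mem_nhdsWithin] with y hy
    have hy : 0 < y := hy
    rw [im_resolventTransform _ hy]
    exact integral_nonneg fun l => by positivity
  · refine le_of_tendsto (hlim x hx) ?_
    filter_upwards [self_mem_nhdsWithin] with y hy
    exact (le_abs_self _).trans (hbound x hx y hy)

/-- An atom at `x` would contribute `π μ{x}` to the integral of `g` over `[x - e, x + e]`, which is
at most `2 C e`. -/
lemma measureReal_singleton_eq_zero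
    (hbound : ∀ x ∈ Ioo A B, ∀ y : ℝ, 0 < y →
      |(resolventTransform μ ((x : ℂ) + y * Complex.I)).im| ≤ C)
    (hlim : ∀ x ∈ Ioo A B, Tendsto (fun y : ℝ =>
      (resolventTransform μ ((x : ℂ) + y * Complex.I)).im) (𝓝[>] 0) (𝓝 (g x)))
    {x : ℝ} (hx : x ∈ Ioo A B) : μ.real {x} = 0 := by
  refine le_antisymm ?_ measureReal_nonneg
  have h : ∀ᶠ e : ℝ in 𝓝[>] 0, Real.pi * μ.real {x} ≤ C * (2 * e) := by
    have e1 : ∀ᶠ e : ℝ in 𝓝[>] 0, A < x - e :=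
      eventually_nhdsWithin_of_eventually_nhds
        (Tendsto.eventually_const_lt (by simpa using hx.1)
          (by fun_prop : ContinuousAt (fun e : ℝ => x - e) 0))
    have e2 : ∀ᶠ e : ℝ in 𝓝[>] 0, x + e < B :=
      eventually_nhdsWithin_of_eventually_nhds
        (Tendsto.eventually_lt_const (by simpa using hx.2)
          (by fun_prop : ContinuousAt (fun e : ℝ => x + e) 0))
    filter_upwards [e1, e2, self_mem_nhdsWithin] with e h1 h2 he
    have he : 0 < e := he
    have h3 := integral_boundary hbound hlim h1 (by linarith : x - e < x + e) h2
    have h4 : μ.real {x} ≤ μ.real (Ioo (x - e) (x + e)) :=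
      measureReal_mono (singleton_subset_iff.2 ⟨by linarith, by linarith⟩)
    have h5 : ‖∫ t in (x - e)..(x + e), g t‖ ≤ C * |x + e - (x - e)| := by
      refine intervalIntegral.norm_integral_le_of_norm_le_const fun t ht => ?_
      rw [uIoc_of_le (by linarith)] at ht
      have := boundary_mem_Icc hbound hlim (x := t) ⟨h1.trans ht.1, ht.2.trans_lt h2⟩
      rw [Real.norm_eq_abs, abs_of_nonneg this.1]
      exact this.2
    have h6 : |x + e - (x - e)| = 2 * e := by rw [abs_of_pos] <;> linarith
    rw [h6] at h5
    have h7 := (le_abs_self _).trans h5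
    rw [h3] at h7
    have := measureReal_nonneg (μ := μ) (s := {x - e})
    have := measureReal_nonneg (μ := μ) (s := {x + e})
    have := Real.pi_pos
    nlinarith
  have h2 : Tendsto (fun e : ℝ => C * (2 * e)) (𝓝[>] 0) (𝓝 0) := by
    have : Continuous fun e : ℝ => C * (2 * e) := by fun_prop
    simpa using (this.tendsto 0).mono_left nhdsWithin_le_nhds
  have h3 := ge_of_tendsto h2 h
  have := Real.pi_pos
  exact nonpos_of_mul_nonpos_right h3 this

lemma restrict_Ioo_eq (hg : ContinuousOn g (Ioo A B))
    (hbound : ∀ x ∈ Ioo A B, ∀ y : ℝ, 0 < y →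
      |(resolventTransform μ ((x : ℂ) + y * Complex.I)).im| ≤ C)
    (hlim : ∀ x ∈ Ioo A B, Tendsto (fun y : ℝ =>
      (resolventTransform μ ((x : ℂ) + y * Complex.I)).im) (𝓝[>] 0) (𝓝 (g x)))
    {a b : ℝ} (ha : A < a) (hb : b < B) :
    μ.restrict (Ioo a b) =
      (volume.restrict (Ioo a b)).withDensity fun x => ENNReal.ofReal (1 / Real.pi * g x) := by
  refine Real.measure_ext_Ioo_rat fun p q => ?_
  rw [withDensity_apply _ measurableSet_Ioo, Measure.restrict_restrict measurableSet_Ioo,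
    Measure.restrict_apply measurableSet_Ioo, Ioo_inter_Ioo]
  set p' : ℝ := (p : ℝ) ⊔ a
  set q' : ℝ := (q : ℝ) ⊓ b
  rcases le_or_gt q' p' with h | h
  · rw [Ioo_eq_empty (not_lt.2 h)]
    simp
  have hp : A < p' := ha.trans_le le_sup_right
  have hq : q' < B := inf_le_right.trans_lt hb
  have hint := integral_boundary hbound hlim hp h hq
  rw [measureReal_singleton_eq_zero hbound hlim ⟨hp, h.trans hq⟩,
    measureReal_singleton_eq_zero hbound hlim ⟨hp.trans h, hq⟩, add_zero, zero_div, add_zero] at hint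
  have hsub : Icc p' q' ⊆ Ioo A B := fun x hx => ⟨hp.trans_le hx.1, hx.2.trans_lt hq⟩
  have hgint : IntegrableOn (fun x => 1 / Real.pi * g x) (Ioo p' q') :=
    ((hg.mono hsub).const_smul (1 / Real.pi)).integrableOn_Icc.mono_set Ioo_subset_Icc_self
  have hnn : 0 ≤ᵐ[volume.restrict (Ioo p' q')] fun x => 1 / Real.pi * g x := by
    refine (ae_restrict_iff' measurableSet_Ioo).2 (ae_of_all _ fun x hx => ?_)
    have := (boundary_mem_Icc hbound hlim (hsub (Ioo_subset_Icc_self hx))).1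
    have := Real.pi_pos
    positivity
  rw [← ofReal_integral_eq_lintegral_ofReal hgint hnn, integral_const_mul,
    ← integral_Ioc_eq_integral_Ioo, ← intervalIntegral.integral_of_le h.le, hint, ← mul_assoc,
    one_div, inv_mul_cancel₀ Real.pi_ne_zero, one_mul, ofReal_measureReal]

end density

end StieltjesInversion

/-! ### Integral representation of holomorphic functions with nonnegative imaginary part -/

namespace Nevanlinna

lemma circleMap_mem (θ : ℝ) : ‖circleMap 0 1 θ‖ = 1 := by simp

lemma sub_circleMap_ne_zero {w : ℂ} (hw : w ∈ Metric.ball (0 : ℂ) 1) (θ : ℝ) :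
    circleMap 0 1 θ - w ≠ 0 := by
  intro h
  rw [sub_eq_zero] at h
  rw [mem_ball_zero_iff, ← h, circleMap_mem] at hw
  exact lt_irrefl _ hw

lemma poissonKernel_nonneg {w : ℂ} (hw : w ∈ Metric.ball (0 : ℂ) 1) (θ : ℝ) :
    0 ≤ poissonKernel 0 w (circleMap 0 1 θ) := by
  rw [mem_ball_zero_iff] at hw
  rw [poissonKernel_def, sub_zero, sub_zero, circleMap_mem]
  have : ‖w‖ ^ 2 ≤ 1 := pow_le_one₀ (norm_nonneg _) hw.le
  exact div_nonneg (by linarith) (by positivity)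

lemma continuous_poissonKernel {w : ℂ} (hw : w ∈ Metric.ball (0 : ℂ) 1) :
    Continuous fun θ : ℝ => poissonKernel 0 w (circleMap 0 1 θ) := by
  simp only [poissonKernel_def, sub_zero, circleMap_mem]
  refine continuous_const.div (by fun_prop) fun θ => ?_
  have := norm_pos_iff.2 (sub_circleMap_ne_zero hw θ)
  positivity

lemma poissonKernel_le {w : ℂ} (hw : w ∈ Metric.ball (0 : ℂ) 1) (θ : ℝ) :
    poissonKernel 0 w (circleMap 0 1 θ) ≤ 1 / (1 - ‖w‖) ^ 2 := by
  simp only [poissonKernel_def, sub_zero, circleMap_mem]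
  rw [mem_ball_zero_iff] at hw
  have h1 : 1 - ‖w‖ ≤ ‖circleMap 0 1 θ - w‖ := by
    have := norm_sub_norm_le (circleMap 0 1 θ) w
    rwa [circleMap_mem] at this
  have h2 : 0 < 1 - ‖w‖ := by linarith
  gcongr
  have := sq_nonneg ‖w‖
  linarith

/-- The kernel as a bounded continuous function of the angle. -/
def poissonBCF {w : ℂ} (hw : w ∈ Metric.ball (0 : ℂ) 1) : BoundedContinuousFunction ℝ ℝ :=
  BoundedContinuousFunction.ofNormedAddCommGroup
    (fun θ : ℝ => poissonKernel 0 w (circleMap 0 1 θ)) (continuous_poissonKernel hw)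
    (1 / (1 - ‖w‖) ^ 2) fun θ => by
      rw [Real.norm_eq_abs, abs_of_nonneg (poissonKernel_nonneg hw θ)]
      exact poissonKernel_le hw θ

variable {H : ℂ → ℂ}

/-- The Poisson formula on a smaller disc, written with a measure on `[0, 2π]`. -/
lemma exists_measure_of_lt_one (hH : DifferentiableOn ℂ H (Metric.ball 0 1))
    (hre : ∀ w ∈ Metric.ball (0 : ℂ) 1, 0 ≤ (H w).re) {r : ℝ} (hr0 : 0 < r) (hr1 : r < 1) :
    ∃ ν : FiniteMeasure ℝ, ν.mass ≤ (H 0).re.toNNReal ∧ ν (Icc 0 (2 * Real.pi))ᶜ = 0 ∧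
      ∀ w ∈ Metric.ball (0 : ℂ) 1,
        ∫ θ, poissonKernel 0 w (circleMap 0 1 θ) ∂(ν : Measure ℝ) = (H (r * w)).re := by
  have hmaps : ∀ w : ℂ, ‖w‖ ≤ 1 → (r * w : ℂ) ∈ Metric.ball (0 : ℂ) 1 := by
    intro w hw
    rw [mem_ball_zero_iff, norm_mul, Complex.norm_real, Real.norm_eq_abs, abs_of_pos hr0]
    nlinarith [norm_nonneg w]
  have hcont : ContinuousOn (fun w : ℂ => H (r * w)) (Metric.closedBall 0 1) :=
    hH.continuousOn.comp (by fun_prop) fun w hw => hmaps w (mem_closedBall_zero_iff.1 hw)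
  have hdiff : DiffContOnCl ℂ (fun w : ℂ => H (r * w)) (Metric.ball 0 1) := by
    refine ⟨hH.comp (by fun_prop) fun w hw => hmaps w (mem_ball_zero_iff.1 hw).le, ?_⟩
    rwa [closure_ball _ one_ne_zero]
  set ρ : ℝ → ℝ := fun θ => (2 * Real.pi)⁻¹ * (H (r * circleMap 0 1 θ)).re
  have hρc : Continuous ρ := by
    have : Continuous fun θ : ℝ => H (r * circleMap 0 1 θ) :=
      hcont.comp_continuous (continuous_circleMap 0 1) fun θ => by simp
    exact continuous_const.mul (Complex.continuous_re.comp this)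
  have hρ0 : ∀ θ, 0 ≤ ρ θ := fun θ =>
    mul_nonneg (by positivity) (hre _ (hmaps _ (by simp)))
  set ν := (volume.restrict (Ioc 0 (2 * Real.pi))).withDensity fun θ => ENNReal.ofReal (ρ θ)
  have hρint : IntegrableOn ρ (Ioc 0 (2 * Real.pi)) :=
    (hρc.integrableOn_Icc).mono_set Ioc_subset_Icc_self
  have hfin : IsFiniteMeasure ν := isFiniteMeasure_withDensity_ofReal hρint.2
  have hformula : ∀ w ∈ Metric.ball (0 : ℂ) 1,
      ∫ θ, poissonKernel 0 w (circleMap 0 1 θ) ∂ν = (H (r * w)).re := by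
    intro w hw
    have h1 := hdiff.circleAverage_poissonKernel_smul hw
    have hci : CircleIntegrable (poissonKernel 0 w • fun w : ℂ => H (r * w)) 0 1 := by
      have h2 : Continuous fun θ : ℝ => poissonKernel 0 w (circleMap 0 1 θ) •
          H (r * circleMap 0 1 θ) := by
        refine (continuous_poissonKernel hw).smul ?_
        exact hcont.comp_continuous (continuous_circleMap 0 1) fun θ => by simp
      exact h2.intervalIntegrable _ _
    have h3 := Complex.reCLM.circleAverage_comp_comm hci
    rw [h1, Real.circleAverage_def, intervalIntegral.integral_of_le (by positivity)] at h3
    simp only [Complex.reCLM_apply] at h3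
    rw [← h3]
    refine (integral_withDensity_eq_integral_toReal_smul (f := fun θ => ENNReal.ofReal (ρ θ))
      (ENNReal.measurable_ofReal.comp hρc.measurable)
      (ae_of_all _ fun _ => ENNReal.ofReal_lt_top) _).trans ?_
    rw [← integral_smul]
    refine integral_congr_ae (ae_of_all _ fun θ => ?_)
    simp only [ENNReal.toReal_ofReal (hρ0 θ), Function.comp, Pi.smul_apply', smul_eq_mul, ρ,
      Complex.reCLM_apply, Complex.real_smul, Complex.re_ofReal_mul]
    ring
  let N : FiniteMeasure ℝ := ⟨ν, hfin⟩
  refine ⟨N, ?_, (N.null_iff_toMeasure_null _).2 ?_, hformula⟩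
  -- At `w = 0` the kernel is `1`, so the total mass is `Re H(0)` whatever `r` is; this uniformity
  -- permits the weak limit `r → 1`.
  · have h0 := hformula 0 (by simp)
    have h1 : ∀ θ, poissonKernel 0 0 (circleMap 0 1 θ) = 1 := by
      intro θ; simp [poissonKernel_def]
    simp only [h1, mul_zero, integral_const, smul_eq_mul, mul_one] at h0
    rw [← h0]
    exact le_of_eq (by simp [N, FiniteMeasure.mass, Measure.real, ENNReal.toReal])
  · change ν _ = 0
    refine withDensity_absolutelyContinuous _ _ ?_
    rw [Measure.restrict_apply measurableSet_Icc.compl]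
    have : (Icc 0 (2 * Real.pi))ᶜ ∩ Ioc 0 (2 * Real.pi) = ∅ := by
      ext x
      simp only [mem_inter_iff, mem_compl_iff, mem_Icc, mem_Ioc, mem_empty_iff_false, iff_false]
      rintro ⟨h1, h2⟩
      exact h1 ⟨h2.1.le, h2.2⟩
    rw [this, measure_empty]

/-- **Herglotz representation** on the unit disc. -/
theorem exists_measure_disc (hH : DifferentiableOn ℂ H (Metric.ball 0 1))
    (hre : ∀ w ∈ Metric.ball (0 : ℂ) 1, 0 ≤ (H w).re) :
    ∃ ν : Measure ℝ, IsFiniteMeasure ν ∧ ∀ w ∈ Metric.ball (0 : ℂ) 1,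
        ∫ θ, poissonKernel 0 w (circleMap 0 1 θ) ∂ν = (H w).re := by
  -- The shift by `2` keeps `r 0` positive.
  set r : ℕ → ℝ := fun n => 1 - 1 / ((n : ℝ) + 2)
  have hr0 : ∀ n, 0 < r n := fun n => by
    have : 1 / ((n : ℝ) + 2) < 1 := by
      rw [div_lt_one (by positivity)]
      have : (0 : ℝ) ≤ n := n.cast_nonneg
      linarith
    simp only [r]; linarith
  have hr1 : ∀ n, r n < 1 := fun n => by
    have : 0 < 1 / ((n : ℝ) + 2) := by positivity
    simp only [r]; linarith
  have hr : Tendsto r atTop (𝓝 1) := by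
    have : Tendsto (fun n : ℕ => 1 / ((n : ℝ) + 2)) atTop (𝓝 0) :=
      tendsto_const_nhds.div_atTop (tendsto_atTop_add_const_right _ _ tendsto_natCast_atTop_atTop)
    simpa [r] using this.const_sub 1
  choose ν hmass hsupp hν using fun n => exists_measure_of_lt_one hH hre (hr0 n) (hr1 n)
  obtain ⟨ν₀, -, hν₀⟩ := (isCompact_setOfPred_finiteMeasure_le_of_isCompact
    (H 0).re.toNNReal (isCompact_Icc (a := (0 : ℝ)) (b := 2 * Real.pi))).exists_mapClusterPt
    (f := atTop) (u := ν) (tendsto_principal.2 (Eventually.of_forall fun n => ⟨hmass n, hsupp n⟩))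
  refine ⟨ν₀, inferInstance, fun w hw => ?_⟩
  have h1 := hν₀.continuousAt_comp
    (FiniteMeasure.continuous_integral_boundedContinuousFunction (poissonBCF hw)).continuousAt
  have h2 : Tendsto ((fun μ : FiniteMeasure ℝ => ∫ θ, poissonBCF hw θ ∂(μ : Measure ℝ)) ∘ ν) atTop
      (𝓝 (H w).re) := by
    have h3 : ContinuousAt (fun s : ℝ => (H (s * w)).re) 1 := by
      have h4 : ContinuousAt H (((1 : ℝ) : ℂ) * w) := by
        simp only [Complex.ofReal_one, one_mul]
        exact hH.continuousOn.continuousAt (Metric.isOpen_ball.mem_nhds hw)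
      exact Complex.continuous_re.continuousAt.comp
        (ContinuousAt.comp (f := fun s : ℝ => (s : ℂ) * w) h4 (by fun_prop))
    have h5 := h3.tendsto.comp hr
    simp only [Complex.ofReal_one, one_mul] at h5
    refine h5.congr fun n => ?_
    exact (hν n w hw).symm
  have := h1.clusterPt.mono h2
  exact eq_of_nhds_neBot this

/-! ### The Poisson kernel in half-plane coordinates -/

/-- The Cayley transform maps the circle to the real line. -/
def cayleyRe (θ : ℝ) : ℝ := -(circleMap 0 1 θ).im / (1 - (circleMap 0 1 θ).re)

lemma measurable_cayleyRe : Measurable cayleyRe := by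
  unfold cayleyRe
  have h := (continuous_circleMap 0 1).measurable
  exact (Complex.measurable_im.comp h).neg.div ((Complex.measurable_re.comp h).const_sub 1)

lemma add_I_ne_zero {z : ℂ} (hz : 0 ≤ z.im) : z + Complex.I ≠ 0 := by
  intro h
  have := congrArg Complex.im h
  simp at this
  linarith

lemma cayley_mem_ball {z : ℂ} (hz : 0 < z.im) :
    (z - Complex.I) / (z + Complex.I) ∈ Metric.ball (0 : ℂ) 1 := by
  have h := norm_pos_iff.2 (add_I_ne_zero hz.le)
  rw [mem_ball_zero_iff, norm_div, div_lt_one h]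
  refine lt_of_pow_lt_pow_left₀ 2 h.le ?_
  rw [Complex.sq_norm, Complex.sq_norm, Complex.normSq_apply, Complex.normSq_apply]
  simp
  nlinarith

lemma one_sub_norm_cayley_sq {z : ℂ} (hz : 0 < z.im) :
    1 - ‖(z - Complex.I) / (z + Complex.I)‖ ^ 2 = 4 * z.im / ‖z + Complex.I‖ ^ 2 := by
  have h := norm_pos_iff.2 (add_I_ne_zero hz.le)
  have h2 : ‖z + Complex.I‖ ^ 2 - ‖z - Complex.I‖ ^ 2 = 4 * z.im := by
    rw [Complex.sq_norm, Complex.sq_norm, Complex.normSq_apply, Complex.normSq_apply]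
    simp
    ring
  rw [norm_div, div_pow, ← h2]
  field_simp

/-- The point `1` of the circle is the point at infinity of the line; mass there would give the
linear term in the Nevanlinna representation. -/
lemma poissonKernel_cayley_of_eq_one {z : ℂ} (hz : 0 < z.im) {θ : ℝ} (hθ : circleMap 0 1 θ = 1) :
    poissonKernel 0 ((z - Complex.I) / (z + Complex.I)) (circleMap 0 1 θ) = z.im := by
  have h := norm_pos_iff.2 (add_I_ne_zero hz.le)
  have h0 := add_I_ne_zero hz.le
  have h1 : 1 - (z - Complex.I) / (z + Complex.I) = 2 * Complex.I / (z + Complex.I) := by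
    field_simp
    ring
  rw [poissonKernel_def, sub_zero, sub_zero, circleMap_mem, one_pow, one_sub_norm_cayley_sq hz, hθ, h1,
    norm_div, norm_mul, Complex.norm_I]
  simp
  field_simp
  norm_num

lemma poissonKernel_cayley {z : ℂ} (hz : 0 < z.im) {θ : ℝ} (hθ : circleMap 0 1 θ ≠ 1) :
    poissonKernel 0 ((z - Complex.I) / (z + Complex.I)) (circleMap 0 1 θ) =
      (1 + cayleyRe θ ^ 2) * (resolvent z (cayleyRe θ)).im := by
  have h := norm_pos_iff.2 (add_I_ne_zero hz.le)
  have h0 := add_I_ne_zero hz.le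
  set ζ := circleMap 0 1 θ with hζ
  set x := cayleyRe θ with hx
  have hnorm : ζ.re ^ 2 + ζ.im ^ 2 = 1 := by
    have h2 : ‖ζ‖ ^ 2 = 1 := by rw [circleMap_mem, one_pow]
    rw [Complex.sq_norm, Complex.normSq_apply] at h2
    linarith
  have hre : 1 - ζ.re ≠ 0 := by
    intro h1
    have h2 : ζ.re = 1 := by linarith
    rw [h2] at hnorm
    refine hθ (Complex.ext (by simpa using h2) ?_)
    simp only [Complex.one_im]
    nlinarith
  have hx1 : x * (1 - ζ.re) = -ζ.im := by
    rw [hx, cayleyRe]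
    exact div_mul_cancel₀ _ hre
  have hx2 : -(x * ζ.im) = 1 + ζ.re := by
    apply mul_right_cancel₀ hre
    linear_combination (-ζ.im) * hx1 + hnorm
  have hxI : (x : ℂ) + Complex.I ≠ 0 := add_I_ne_zero (by simp)
  have hζx : ζ = (x - Complex.I) / (x + Complex.I) := by
    rw [eq_div_iff hxI]
    apply Complex.ext
    · simp
      linear_combination -hx1
    · simp
      linear_combination -hx2
  have hsub : ζ - (z - Complex.I) / (z + Complex.I) =
      2 * Complex.I * (x - z) / ((x + Complex.I) * (z + Complex.I)) := by
    rw [hζx]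
    field_simp
    ring
  have hxz : (x : ℂ) - z ≠ 0 := by
    intro h1
    have := congrArg Complex.im h1
    simp at this
    exact hz.ne' this
  have hxn : ‖(x : ℂ) + Complex.I‖ ^ 2 = 1 + x ^ 2 := by
    rw [Complex.sq_norm, Complex.normSq_apply]
    simp
    ring
  have hxz' := norm_pos_iff.2 hxz
  have hxI' := norm_pos_iff.2 hxI
  rw [poissonKernel_def, sub_zero, sub_zero, circleMap_mem, one_pow, one_sub_norm_cayley_sq hz, hsub,
    ← hxn, StieltjesInversion.resolvent_eq, Complex.inv_im, ← Complex.sq_norm, norm_div, norm_mul,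
    norm_mul, norm_mul, Complex.norm_I]
  simp
  field_simp
  norm_num

variable {T : ℂ → ℂ}

/-- The Herglotz representation is applied to `-i T ∘ φ`, where `φ` is the inverse Cayley map, so
that its real part is `Im T`. -/
lemma exists_measure_angle (hT : DifferentiableOn ℂ T {z | 0 < z.im})
    (him : ∀ z : ℂ, 0 < z.im → 0 ≤ (T z).im) :
    ∃ ν : Measure ℝ, IsFiniteMeasure ν ∧ ∀ z : ℂ, 0 < z.im →
      ∫ θ, poissonKernel 0 ((z - Complex.I) / (z + Complex.I)) (circleMap 0 1 θ) ∂ν = (T z).im := by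
  set φ : ℂ → ℂ := fun w => Complex.I * (1 + w) / (1 - w)
  have hne : ∀ w ∈ Metric.ball (0 : ℂ) 1, 1 - w ≠ 0 := by
    intro w hw h
    rw [sub_eq_zero] at h
    rw [mem_ball_zero_iff, ← h, norm_one] at hw
    exact lt_irrefl _ hw
  have hφ : ∀ w ∈ Metric.ball (0 : ℂ) 1, 0 < (φ w).im := by
    intro w hw
    have h1 := Complex.normSq_pos.2 (hne w hw)
    rw [mem_ball_zero_iff] at hw
    have h2 : ‖w‖ ^ 2 < 1 := pow_lt_one₀ (norm_nonneg _) hw two_ne_zero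
    rw [Complex.sq_norm, Complex.normSq_apply] at h2
    have h3 : (φ w).im = (1 - (w.re * w.re + w.im * w.im)) / Complex.normSq (1 - w) := by
      simp only [φ, Complex.div_im]
      simp
      field_simp
      ring
    rw [h3]
    exact div_pos (by linarith) h1
  have hdφ : DifferentiableOn ℂ φ (Metric.ball 0 1) := by
    refine DifferentiableOn.div (by fun_prop) (by fun_prop) hne
  obtain ⟨ν, hν, hform⟩ := exists_measure_disc (H := fun w => -Complex.I * T (φ w))
    ((hT.comp hdφ hφ).const_mul _) (fun w hw => by simpa using him _ (hφ w hw))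
  refine ⟨ν, hν, fun z hz => ?_⟩
  have h0 := add_I_ne_zero hz.le
  rw [hform _ (cayley_mem_ball hz)]
  have : φ ((z - Complex.I) / (z + Complex.I)) = z := by
    have h1 : 1 - (z - Complex.I) / (z + Complex.I) = 2 * Complex.I / (z + Complex.I) := by
      field_simp
      ring
    simp only [φ, h1]
    field_simp
    ring
  rw [this]
  simp

end Nevanlinna

/-! ### From the angular measure to a finite measure on the line -/

namespace Nevanlinna

variable {T : ℂ → ℂ} {C : ℝ}

lemma im_resolvent_I (x : ℝ) (y : ℝ) :
    (resolvent ((y : ℂ) * Complex.I) x).im = y / (x ^ 2 + y ^ 2) := by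
  have := StieltjesInversion.im_resolvent 0 y x
  simpa using this

/-- If `y Im T(iy)` is bounded, the representing measure has no mass at the point at infinity, and a
finite second moment in the half-plane coordinate. -/
lemma angle_measure_moments {ν : Measure ℝ} [IsFiniteMeasure ν]
    (hν : ∀ z : ℂ, 0 < z.im →
      ∫ θ, poissonKernel 0 ((z - Complex.I) / (z + Complex.I)) (circleMap 0 1 θ) ∂ν = (T z).im)
    (hbound : ∀ y : ℝ, 0 < y → y * (T (y * Complex.I)).im ≤ C) :
    (∀ᵐ θ ∂ν, circleMap 0 1 θ ≠ 1) ∧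
      ∫⁻ θ, ENNReal.ofReal (1 + cayleyRe θ ^ 2) ∂ν ≠ ⊤ := by
  have hmem : ∀ y : ℝ, 0 < y → 0 < ((y : ℂ) * Complex.I).im := fun y hy => by simpa using hy
  set P : ℝ → ℝ → ℝ := fun y θ =>
    poissonKernel 0 (((y : ℂ) * Complex.I - Complex.I) / ((y : ℂ) * Complex.I + Complex.I))
      (circleMap 0 1 θ)
  have hPint : ∀ y, 0 < y → Integrable (P y) ν := fun y hy =>
    (poissonBCF (cayley_mem_ball (hmem y hy))).integrable ν
  have hP0 : ∀ y, 0 < y → ∀ θ, 0 ≤ P y θ := fun y hy θ =>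
    poissonKernel_nonneg (cayley_mem_ball (hmem y hy)) θ
  have hPle : ∀ y, 0 < y → ∫ θ, y * P y θ ∂ν ≤ C := by
    intro y hy
    rw [integral_const_mul, hν _ (hmem y hy)]
    exact hbound y hy
  have hC : 0 ≤ C := (integral_nonneg fun θ => mul_nonneg zero_le_one (hP0 1 one_pos θ)).trans
    (hPle 1 one_pos)
  have hmeas : MeasurableSet {θ : ℝ | circleMap 0 1 θ = 1} :=
    (isClosed_eq (continuous_circleMap 0 1) continuous_const).measurableSet
  have hatom : ∀ᵐ θ ∂ν, circleMap 0 1 θ ≠ 1 := by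
    rw [ae_iff]
    simp only [not_not]
    rw [← measureReal_eq_zero_iff]
    refine le_antisymm ?_ measureReal_nonneg
    -- At infinity the kernel for `z = i y` equals `y`, so an atom would contribute its mass times
    -- `y²` to `y Im T(iy)`.
    have h1 : ∀ y : ℝ, 0 < y → ν.real {θ : ℝ | circleMap 0 1 θ = 1} ≤ C / y ^ 2 := by
      intro y hy
      rw [le_div_iff₀ (by positivity)]
      refine le_trans ?_ (hPle y hy)
      calc ν.real {θ : ℝ | circleMap 0 1 θ = 1} * y ^ 2
          = ∫ θ in {θ : ℝ | circleMap 0 1 θ = 1}, y ^ 2 ∂ν := by simp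
        _ = ∫ θ in {θ : ℝ | circleMap 0 1 θ = 1}, y * P y θ ∂ν := by
            refine setIntegral_congr_fun hmeas fun θ hθ => ?_
            simp only [P]
            rw [poissonKernel_cayley_of_eq_one (hmem y hy) hθ]
            simp [sq]
        _ ≤ ∫ θ, y * P y θ ∂ν := setIntegral_le_integral ((hPint y hy).const_mul y)
            (ae_of_all _ fun θ => mul_nonneg hy.le (hP0 y hy θ))
    have h2 : Tendsto (fun y : ℝ => C / y ^ 2) atTop (𝓝 0) :=
      tendsto_const_nhds.div_atTop (tendsto_pow_atTop two_ne_zero)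
    refine ge_of_tendsto h2 ?_
    filter_upwards [eventually_gt_atTop 0] with y hy using h1 y hy
  refine ⟨hatom, ?_⟩
  set F : ℕ → ℝ → ENNReal := fun n θ => ENNReal.ofReal (((n : ℝ) + 1) * P ((n : ℝ) + 1) θ)
  have hn : ∀ n : ℕ, (0 : ℝ) < (n : ℝ) + 1 := fun n => by positivity
  have hFmeas : ∀ n, Measurable (F n) := fun n =>
    ENNReal.measurable_ofReal.comp
      ((continuous_poissonKernel (cayley_mem_ball (hmem _ (hn n)))).measurable.const_mul _)
  have hFint : ∀ n, ∫⁻ θ, F n θ ∂ν ≤ ENNReal.ofReal C := by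
    intro n
    rw [← ofReal_integral_eq_lintegral_ofReal ((hPint _ (hn n)).const_mul _)
      (ae_of_all _ fun θ => mul_nonneg (hn n).le (hP0 _ (hn n) θ))]
    exact ENNReal.ofReal_le_ofReal (hPle _ (hn n))
  have hlim : ∀ᵐ θ ∂ν, Tendsto (fun n => F n θ) atTop (𝓝 (ENNReal.ofReal (1 + cayleyRe θ ^ 2))) := by
    filter_upwards [hatom] with θ hθ
    refine ENNReal.tendsto_ofReal ?_
    have h1 : ∀ n : ℕ, ((n : ℝ) + 1) * P ((n : ℝ) + 1) θ =
        (1 + cayleyRe θ ^ 2) * (1 + cayleyRe θ ^ 2 / ((n : ℝ) + 1) ^ 2)⁻¹ := by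
      intro n
      simp only [P]
      rw [poissonKernel_cayley (hmem _ (hn n)) hθ, im_resolvent_I]
      have := hn n
      field_simp
      ring
    simp_rw [h1]
    have h2 : Tendsto (fun n : ℕ => cayleyRe θ ^ 2 / ((n : ℝ) + 1) ^ 2) atTop (𝓝 0) :=
      tendsto_const_nhds.div_atTop ((tendsto_pow_atTop two_ne_zero).comp
        (tendsto_atTop_add_const_right _ _ tendsto_natCast_atTop_atTop))
    have h3 := ((h2.const_add 1).inv₀ (by norm_num)).const_mul (1 + cayleyRe θ ^ 2)
    simpa using h3
  -- Fatou: `y` times the kernel is `(1 + x²) / (1 + x² / y²)`, which tends to `1 + x²` along `y = n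
  -- + 1`.
  have h1 : ∫⁻ θ, ENNReal.ofReal (1 + cayleyRe θ ^ 2) ∂ν ≤ ENNReal.ofReal C := by
    calc _ = ∫⁻ θ, liminf (fun n => F n θ) atTop ∂ν := by
          refine lintegral_congr_ae ?_
          filter_upwards [hlim] with θ hθ using hθ.liminf_eq.symm
      _ ≤ liminf (fun n => ∫⁻ θ, F n θ ∂ν) atTop := lintegral_liminf_le hFmeas
      _ ≤ ENNReal.ofReal C := by
          refine liminf_le_of_frequently_le' (Frequently.of_forall hFint)
  exact (h1.trans_lt ENNReal.ofReal_lt_top).ne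

lemma notMem_support_of_im_pos {μ : Measure ℝ} {z : ℂ} (hz : 0 < z.im) :
    z ∉ algebraMap ℝ ℂ '' μ.support := by
  rintro ⟨x, -, rfl⟩
  simp at hz

/-- A holomorphic function with nonnegative imaginary part on the upper half-plane, which is
`O(1/z)`, is the Stieltjes transform of a finite measure. -/
theorem exists_stieltjes_measure (hT : DifferentiableOn ℂ T {z | 0 < z.im})
    (him : ∀ z : ℂ, 0 < z.im → 0 ≤ (T z).im) (hbound : ∀ z : ℂ, 0 < z.im → ‖z * T z‖ ≤ C) :
    ∃ μ : Measure ℝ, IsFiniteMeasure μ ∧ ∀ z : ℂ, 0 < z.im → resolventTransform μ z = T z := by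
  obtain ⟨ν, hν, hform⟩ := exists_measure_angle hT him
  have hb : ∀ y : ℝ, 0 < y → y * ‖T (y * Complex.I)‖ ≤ C := by
    intro y hy
    have h1 := hbound (y * Complex.I) (by simpa using hy)
    rwa [norm_mul, norm_mul, Complex.norm_I, Complex.norm_real, Real.norm_eq_abs, abs_of_pos hy,
      mul_one] at h1
  obtain ⟨hae, hfin⟩ := angle_measure_moments hform (C := C) fun y hy =>
    (mul_le_mul_of_nonneg_left ((le_abs_self _).trans (Complex.abs_im_le_norm _)) hy.le).trans (hb y hy)
  have hdm : Measurable fun θ => ENNReal.ofReal (1 + cayleyRe θ ^ 2) :=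
    ENNReal.measurable_ofReal.comp ((measurable_cayleyRe.pow_const 2).const_add 1)
  set N := ν.withDensity fun θ => ENNReal.ofReal (1 + cayleyRe θ ^ 2) with hN
  have hNfin : IsFiniteMeasure N := isFiniteMeasure_withDensity hfin
  set μ := N.map cayleyRe with hμ
  have hμfin : IsFiniteMeasure μ := by rw [hμ]; infer_instance
  have hIm : ∀ z : ℂ, 0 < z.im → (resolventTransform μ z).im = (T z).im := by
    intro z hz
    have h1 := (Complex.imCLM.integral_comp_comm
      (StieltjesInversion.integrable_resolvent (μ := μ) hz)).symm
    simp only [Complex.imCLM_apply] at h1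
    rw [resolventTransform_apply, h1, hμ, integral_map measurable_cayleyRe.aemeasurable
      (f := fun x : ℝ => (resolvent z x).im) (Complex.measurable_im.comp measurable_resolvent).aestronglyMeasurable, hN,
      integral_withDensity_eq_integral_toReal_smul hdm (ae_of_all _ fun _ => ENNReal.ofReal_lt_top),
      ← hform z hz]
    refine integral_congr_ae ?_
    filter_upwards [hae] with θ hθ
    rw [poissonKernel_cayley hz hθ, ENNReal.toReal_ofReal (by positivity), smul_eq_mul]
  have hdiff : DifferentiableOn ℂ (fun z => resolventTransform μ z - T z) {z : ℂ | 0 < z.im} := by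
    intro z hz
    exact ((hasDerivAt_resolventTransform z
      (notMem_support_of_im_pos hz)).differentiableAt.differentiableWithinAt).sub (hT z hz)
  have han := hdiff.analyticOnNhd CanonicalCurve.isOpen_upperHalf
  refine ⟨μ, hμfin, ?_⟩
  -- The difference is holomorphic and real-valued, so by the open mapping theorem it is constant;
  -- both terms are `O(1/y)` on the imaginary axis, so the constant is `0`.
  rcases han.is_constant_or_isOpen CanonicalCurve.isPreconnected_upperHalf with ⟨w, hw⟩ | hopen
  · have hw0 : w = 0 := by
      have h1 : Tendsto (fun y : ℝ => (μ.real univ + C) / y) atTop (𝓝 0) :=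
        tendsto_const_nhds.div_atTop tendsto_id
      rw [← norm_le_zero_iff]
      refine ge_of_tendsto h1 ?_
      filter_upwards [eventually_gt_atTop 0] with y hy
      have hz : 0 < ((y : ℂ) * Complex.I).im := by simpa using hy
      rw [← hw _ hz, add_div]
      refine (norm_sub_le _ _).trans (add_le_add ?_ ?_)
      · have h2 := norm_integral_le_of_norm_le_const (μ := μ)
          (ae_of_all _ fun l => StieltjesInversion.norm_resolvent_le hz l)
        refine h2.trans (le_of_eq ?_)
        simp
        ring
      · rw [le_div_iff₀ hy, mul_comm]
        exact hb y hy
    intro z hz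
    have := hw z hz
    rw [hw0] at this
    exact sub_eq_zero.1 this
  · exfalso
    have h1 := hopen _ subset_rfl CanonicalCurve.isOpen_upperHalf
    have hI : Complex.I ∈ {z : ℂ | 0 < z.im} := by simp
    obtain ⟨ε, hε, hball⟩ := Metric.isOpen_iff.1 h1 _ ⟨Complex.I, hI, rfl⟩
    set p := resolventTransform μ Complex.I - T Complex.I
    obtain ⟨z, hz, hzp⟩ := hball (show p + (ε / 2 : ℝ) * Complex.I ∈ Metric.ball p ε by
      rw [Metric.mem_ball, dist_eq_norm, add_sub_cancel_left, norm_mul, Complex.norm_I,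
        Complex.norm_real, Real.norm_eq_abs, abs_of_pos (by positivity)]
      linarith)
    have h2 := congrArg Complex.im hzp
    have h3 : p.im = 0 := by
      simp only [p, Complex.sub_im, hIm _ hI, sub_self]
    rw [Complex.add_im, h3, Complex.im_ofReal_mul, Complex.I_im, Complex.sub_im, hIm z hz] at h2
    linarith

end Nevanlinna

namespace CanonicalCurve

/-! ### The canonical solution, its measure and its boundary values -/

variable {M : ℕ} {R : Matrix (Fin M) (Fin M) ℂ} {c : ℝ}

lemma isCanonicalSolution_canonicalT (hM : 0 < M) (hR : R.PosDef) (hc : 0 < c) {z : ℂ}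
    (hz : 0 < z.im) : IsCanonicalSolution R c z (canonicalT R c z) := by
  have h : ∃ s, IsCanonicalSolution R c z s :=
    ⟨_, (isCanonicalSolution_iff hM hR hc (ne_zero_of_im_pos hz)).2
      ⟨_, onCurve_uOf hM (fun i => hR.eigenvalues_pos i) hc hz, rfl⟩⟩
  rw [canonicalT, dif_pos h]
  exact h.choose_spec

lemma isCanonicalSolution_unique (hM : 0 < M) (hR : R.PosDef) (hc : 0 < c) {z s : ℂ}
    (hz : 0 < z.im) (hs : IsCanonicalSolution R c z s) :
    s = -G hR.1.eigenvalues (uOf hR.1.eigenvalues c z) / z := by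
  obtain ⟨u, hu, rfl⟩ := (isCanonicalSolution_iff hM hR hc (ne_zero_of_im_pos hz)).1 hs
  rw [hu.eq_uOf hM (fun i => hR.eigenvalues_pos i) hc hz]

lemma canonicalT_eq (hM : 0 < M) (hR : R.PosDef) (hc : 0 < c) {z : ℂ} (hz : 0 < z.im) :
    canonicalT R c z = -G hR.1.eigenvalues (uOf hR.1.eigenvalues c z) / z :=
  isCanonicalSolution_unique hM hR hc hz (isCanonicalSolution_canonicalT hM hR hc hz)

lemma canonicalT_im_pos (hM : 0 < M) (hR : R.PosDef) (hc : 0 < c) {z : ℂ} (hz : 0 < z.im) :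
    0 < (canonicalT R c z).im := (isCanonicalSolution_canonicalT hM hR hc hz).1

lemma exists_norm_mul_canonicalT_le (hM : 0 < M) (hR : R.PosDef) (hc : 0 < c) :
    ∃ C : ℝ, 0 < C ∧ ∀ z : ℂ, 0 < z.im → ‖z * canonicalT R c z‖ ≤ C := by
  obtain ⟨C, hC, h⟩ := OnCurve.exists_norm_G_le hM (fun i => hR.eigenvalues_pos i) hc
  refine ⟨C, hC, fun z hz => ?_⟩
  rw [canonicalT_eq hM hR hc hz, mul_t (ne_zero_of_im_pos hz), norm_neg]
  exact h z _ hz.le (onCurve_uOf hM (fun i => hR.eigenvalues_pos i) hc hz)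

lemma differentiableOn_canonicalT (hM : 0 < M) (hR : R.PosDef) (hc : 0 < c) :
    DifferentiableOn ℂ (canonicalT R c) {z | 0 < z.im} := by
  have hlam := fun i => hR.eigenvalues_pos i
  have h : DifferentiableOn ℂ
      (fun z => -G hR.1.eigenvalues (uOf hR.1.eigenvalues c z) / z) {z | 0 < z.im} := by
    intro z hz
    have hz : 0 < z.im := hz
    have hu := (onCurve_uOf hM hlam hc hz).im_pos
    have h1 := (analyticAt_uOf hM hlam hc hz).differentiableAt
    have h2 := (hasStrictDerivAt_G (lam := hR.1.eigenvalues) (ne_zero_of_im_pos hu)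
      fun i => one_add_mul_ne_zero hu _).hasDerivAt.differentiableAt
    exact (((h2.comp z h1).neg).div differentiableAt_id
      (ne_zero_of_im_pos hz)).differentiableWithinAt
  exact h.congr fun z hz => canonicalT_eq hM hR hc hz

lemma mem_closure_upperHalf (x : ℝ) : (x : ℂ) ∈ closure {z : ℂ | 0 < z.im} := by
  rw [Complex.closure_setOfPred_lt_im]; simp

instance neBot_upperHalf (x : ℝ) : (𝓝[{z : ℂ | 0 < z.im}] (x : ℂ)).NeBot :=
  mem_closure_iff_nhdsWithin_neBot.1 (mem_closure_upperHalf x)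

lemma exists_tendsto_canonicalT (hM : 0 < M) (hR : R.PosDef) (hc : 0 < c) {x : ℝ} (hx : x ≠ 0) :
    ∃ p : ℂ, p ≠ 0 ∧ (∀ i, 1 + p * hR.1.eigenvalues i ≠ 0) ∧ Z hR.1.eigenvalues c p = x ∧
      boundaryT R c x = -G hR.1.eigenvalues p / x ∧
      Tendsto (canonicalT R c) (𝓝[{z : ℂ | 0 < z.im}] (x : ℂ)) (𝓝 (boundaryT R c x)) := by
  obtain ⟨p, hp0, hp, hZ, hlim⟩ := exists_tendsto_uOf hM (fun i => hR.eigenvalues_pos i) hc hx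
  have hx0 : (x : ℂ) ≠ 0 := by exact_mod_cast hx
  have h1 : Tendsto (canonicalT R c) (𝓝[{z : ℂ | 0 < z.im}] (x : ℂ))
      (𝓝 (-G hR.1.eigenvalues p / x)) := by
    have h2 := (((continuousAt_G hp).tendsto.comp hlim).neg).div
      (tendsto_id.mono_left nhdsWithin_le_nhds) hx0
    refine h2.congr' ?_
    filter_upwards [self_mem_nhdsWithin] with z hz
    exact (canonicalT_eq hM hR hc hz).symm
  have h3 : boundaryT R c x = -G hR.1.eigenvalues p / x := h1.limUnder_eq
  exact ⟨p, hp0, hp, hZ, h3, h3 ▸ h1⟩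

lemma tendsto_boundaryT (hM : 0 < M) (hR : R.PosDef) (hc : 0 < c) {x : ℝ} (hx : x ≠ 0) :
    Tendsto (canonicalT R c) (𝓝[{z : ℂ | 0 < z.im}] (x : ℂ)) (𝓝 (boundaryT R c x)) := by
  obtain ⟨p, -, -, -, -, h⟩ := exists_tendsto_canonicalT hM hR hc hx
  exact h

lemma boundaryT_im_nonneg (hM : 0 < M) (hR : R.PosDef) (hc : 0 < c) {x : ℝ} (hx : x ≠ 0) :
    0 ≤ (boundaryT R c x).im := by
  refine ge_of_tendsto (Complex.continuous_im.continuousAt.tendsto.comp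
    (tendsto_boundaryT hM hR hc hx)) ?_
  filter_upwards [self_mem_nhdsWithin] with z hz
  exact (canonicalT_im_pos hM hR hc hz).le

/-- The conditions `Im t > 0` and `Im (z t) > 0` pass to the limit as `Im t(x) ≥ 0` and `x Im t(x) ≥
0`, which conflict for `x < 0` unless `Im t(x) = 0`. This is why the measure lives on `[0, ∞)`. -/
lemma boundaryT_im_of_neg (hM : 0 < M) (hR : R.PosDef) (hc : 0 < c) {x : ℝ} (hx : x < 0) :
    (boundaryT R c x).im = 0 := by
  refine le_antisymm ?_ (boundaryT_im_nonneg hM hR hc hx.ne)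
  have h1 : Tendsto (fun z : ℂ => z * canonicalT R c z) (𝓝[{z : ℂ | 0 < z.im}] (x : ℂ))
      (𝓝 (x * boundaryT R c x)) :=
    (tendsto_id.mono_left nhdsWithin_le_nhds).mul (tendsto_boundaryT hM hR hc hx.ne)
  have h2 : 0 ≤ ((x : ℂ) * boundaryT R c x).im := by
    refine ge_of_tendsto (Complex.continuous_im.continuousAt.tendsto.comp h1) ?_
    filter_upwards [self_mem_nhdsWithin] with z hz
    exact (isCanonicalSolution_canonicalT hM hR hc hz).2.1.le
  rw [Complex.im_ofReal_mul] at h2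
  nlinarith

lemma continuousOn_boundaryT (hM : 0 < M) (hR : R.PosDef) (hc : 0 < c) :
    ContinuousOn (boundaryT R c) {x | x ≠ 0} := by
  -- `boundaryT R c x` is by definition the value of `extendFrom` at `x`, so existence of the limits
  -- already yields continuity.
  have h := continuousOn_extendFrom (f := canonicalT R c) (A := {z : ℂ | 0 < z.im})
    (B := Complex.ofReal '' {x : ℝ | x ≠ 0}) (by
      rintro _ ⟨x, -, rfl⟩
      exact mem_closure_upperHalf x) (by
      rintro _ ⟨x, hx, rfl⟩
      exact ⟨_, tendsto_boundaryT hM hR hc hx⟩)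
  exact h.comp Complex.continuous_ofReal.continuousOn fun x hx => ⟨x, hx, rfl⟩

lemma continuousOn_densityF (hM : 0 < M) (hR : R.PosDef) (hc : 0 < c) :
    ContinuousOn (densityF R c) {x | x ≠ 0} :=
  continuousOn_const.mul (Complex.continuous_im.comp_continuousOn
    (continuousOn_boundaryT hM hR hc))

lemma tendsto_vertical (x : ℝ) :
    Tendsto (fun y : ℝ => (x : ℂ) + y * Complex.I) (𝓝[>] 0) (𝓝[{z : ℂ | 0 < z.im}] (x : ℂ)) := by
  refine tendsto_nhdsWithin_iff.2 ⟨?_, ?_⟩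
  · have : Continuous fun y : ℝ => (x : ℂ) + y * Complex.I := by fun_prop
    simpa using (this.tendsto 0).mono_left nhdsWithin_le_nhds
  · filter_upwards [self_mem_nhdsWithin] with y hy
    simpa using hy

/-- A measure whose Stieltjes transform is `t` has density `Im t(x)/π` away from zero. -/
lemma restrict_Ioo_eq_density (hM : 0 < M) (hR : R.PosDef) (hc : 0 < c) {μ : Measure ℝ}
    [IsFiniteMeasure μ] (hμ : ∀ z : ℂ, 0 < z.im → resolventTransform μ z = canonicalT R c z)
    {A B δ a b : ℝ} (hδ : 0 < δ) (hAB : ∀ x ∈ Ioo A B, δ ≤ |x|) (ha : A < a) (hb : b < B) :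
    μ.restrict (Ioo a b) =
      (volume.restrict (Ioo a b)).withDensity fun x => ENNReal.ofReal (densityF R c x) := by
  obtain ⟨C, hC, hbound⟩ := exists_norm_mul_canonicalT_le hM hR hc
  have hne : ∀ x ∈ Ioo A B, x ≠ 0 := by
    rintro x hx rfl
    have := hAB 0 hx
    rw [abs_zero] at this
    linarith
  refine StieltjesInversion.restrict_Ioo_eq (A := A) (B := B) (C := C / δ)
    (g := fun x => (boundaryT R c x).im) ?_ ?_ ?_ ha hb
  · exact Complex.continuous_im.comp_continuousOn ((continuousOn_boundaryT hM hR hc).mono hne)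
  · intro x hx y hy
    have hz : 0 < ((x : ℂ) + y * Complex.I).im := by simpa using hy
    rw [hμ _ hz]
    have h1 := hbound _ hz
    have h2 : |x| ≤ ‖(x : ℂ) + y * Complex.I‖ := by
      have := Complex.abs_re_le_norm ((x : ℂ) + y * Complex.I)
      simpa using this
    rw [norm_mul] at h1
    rw [le_div_iff₀ hδ, mul_comm]
    refine le_trans ?_ h1
    exact mul_le_mul ((hAB x hx).trans h2) (Complex.abs_im_le_norm _) (abs_nonneg _) (norm_nonneg _)
  · intro x hx
    refine ((Complex.continuous_im.continuousAt.tendsto.comp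
      (tendsto_boundaryT hM hR hc (hne x hx))).comp (tendsto_vertical x)).congr' ?_
    filter_upwards [self_mem_nhdsWithin] with y hy
    have hz : 0 < ((x : ℂ) + y * Complex.I).im := by simpa using hy
    simp only [Function.comp]
    rw [hμ _ hz]

lemma iUnion_Ioo_eq_Ioi : ⋃ n : ℕ, Ioo (1 / ((n : ℝ) + 1)) ((n : ℝ) + 1) = Ioi 0 := by
  ext x
  simp only [mem_iUnion, mem_Ioo, mem_Ioi]
  constructor
  · rintro ⟨n, h1, -⟩
    exact lt_trans (by positivity) h1
  · intro hx
    obtain ⟨n, hn⟩ := exists_nat_gt (max x (1 / x))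
    obtain ⟨h1, h2⟩ := max_lt_iff.1 hn
    refine ⟨n, ?_, by linarith⟩
    rw [div_lt_iff₀ hx] at h2
    rw [div_lt_iff₀ (by positivity)]
    nlinarith

lemma iUnion_Ioo_eq_Iio : ⋃ n : ℕ, Ioo (-((n : ℝ) + 1)) (-(1 / ((n : ℝ) + 1))) = Iio 0 := by
  ext x
  have h := congrArg (fun s : Set ℝ => -x ∈ s) iUnion_Ioo_eq_Ioi
  simp only [mem_iUnion, mem_Ioo, mem_Ioi, mem_Iio, eq_iff_iff] at h ⊢
  rw [neg_pos] at h
  rw [← h]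
  refine exists_congr fun n => ⟨fun h => ⟨by linarith [h.2], by linarith [h.1]⟩,
    fun h => ⟨by linarith [h.2], by linarith [h.1]⟩⟩

lemma restrict_Ioi_eq_density (hM : 0 < M) (hR : R.PosDef) (hc : 0 < c) {μ : Measure ℝ}
    [IsFiniteMeasure μ] (hμ : ∀ z : ℂ, 0 < z.im → resolventTransform μ z = canonicalT R c z) :
    μ.restrict (Ioi 0) =
      (volume.restrict (Ioi 0)).withDensity fun x => ENNReal.ofReal (densityF R c x) := by
  rw [← restrict_withDensity measurableSet_Ioi, ← iUnion_Ioo_eq_Ioi, Measure.restrict_iUnion_congr]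
  intro n
  rw [restrict_withDensity measurableSet_Ioo]
  have hn : (0 : ℝ) < 1 / ((n : ℝ) + 1) := by positivity
  refine restrict_Ioo_eq_density hM hR hc hμ (A := 1 / ((n : ℝ) + 1) / 2) (B := (n : ℝ) + 2)
    (half_pos hn) (fun x hx => ?_) (half_lt_self hn) (by linarith)
  exact hx.1.le.trans (le_abs_self x)

lemma measure_Iio_eq_zero (hM : 0 < M) (hR : R.PosDef) (hc : 0 < c) {μ : Measure ℝ}
    [IsFiniteMeasure μ] (hμ : ∀ z : ℂ, 0 < z.im → resolventTransform μ z = canonicalT R c z) :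
    μ (Iio 0) = 0 := by
  rw [← iUnion_Ioo_eq_Iio, measure_iUnion_null_iff]
  intro n
  have hn : (0 : ℝ) < 1 / ((n : ℝ) + 1) := by positivity
  have h := restrict_Ioo_eq_density hM hR hc hμ (A := -((n : ℝ) + 2))
    (B := -(1 / ((n : ℝ) + 1) / 2)) (a := -((n : ℝ) + 1)) (b := -(1 / ((n : ℝ) + 1)))
    (half_pos hn) (fun x hx => by linarith [hx.2, neg_le_abs x]) (by linarith) (by linarith)
  rw [← Measure.restrict_apply_self, h, withDensity_apply _ measurableSet_Ioo,
    Measure.restrict_restrict measurableSet_Ioo, inter_self]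
  refine (setLIntegral_congr_fun measurableSet_Ioo fun x hx => ?_).trans lintegral_zero
  have hx0 : x < 0 := by linarith [hx.2]
  simp only [densityF, boundaryT_im_of_neg hM hR hc hx0, mul_zero, ENNReal.ofReal_zero]

theorem isStieltjesMeasure_canonicalMeasure (hM : 0 < M) (hR : R.PosDef) (hc : 0 < c) :
    IsStieltjesMeasure (canonicalMeasure R c) (canonicalT R c) := by
  have h : ∃ μ : Measure ℝ, IsStieltjesMeasure μ (canonicalT R c) := by
    obtain ⟨C, -, hC⟩ := exists_norm_mul_canonicalT_le hM hR hc
    obtain ⟨μ, hfin, hμ⟩ := Nevanlinna.exists_stieltjes_measure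
      (differentiableOn_canonicalT hM hR hc) (fun z hz => (canonicalT_im_pos hM hR hc hz).le) hC
    exact ⟨μ, hfin, measure_Iio_eq_zero hM hR hc hμ, hμ⟩
  rw [canonicalMeasure, dif_pos h]
  exact h.choose_spec

/-! ### Analyticity in the bulk -/

/-- Near a point of the bulk, the boundary value is the restriction of a holomorphic function. -/
lemma exists_analytic_extension (hM : 0 < M) (hR : R.PosDef) (hc : 0 < c) {x₀ : ℝ} (hx₀ : 0 < x₀)
    (him : 0 < (boundaryT R c x₀).im) :
    ∃ S : ℂ → ℂ, AnalyticAt ℂ S x₀ ∧ ∀ᶠ x : ℝ in 𝓝 x₀, boundaryT R c x = S x := by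
  have hlam := fun i => hR.eigenvalues_pos i
  obtain ⟨p, hp0, hp, hZ, hb, hlim⟩ := exists_tendsto_canonicalT hM hR hc hx₀.ne'
  have hx0 : (x₀ : ℂ) ≠ 0 := by exact_mod_cast hx₀.ne'
  rw [hb] at him
  have hG : G hR.1.eigenvalues p ≠ 0 := by
    intro h
    simp [h] at him
  -- At a real point `Im (x₀ t) = x₀ Im t > 0`, so `Im t > 0` forces `Im p > 0`: the limiting
  -- parameter is a genuine point of the curve, where `Z' ≠ 0`.
  have hcurve : OnCurve hR.1.eigenvalues c x₀ p := by
    refine ⟨?_, hZ, him⟩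
    rw [(im_formulas hx0 (inv_eq_of_Z_eq hc hp0 hG hx0 hZ)).1, Complex.im_ofReal_mul]
    have := norm_pos_iff.2 hp0
    have := norm_pos_iff.2 (ne_zero_of_im_pos him)
    positivity
  obtain ⟨v, hv, hvp, hev⟩ := hcurve.exists_local_inverse hM hlam hc (by simp)
  set S : ℂ → ℂ := fun z => -G hR.1.eigenvalues (v z) / z
  have hGan : AnalyticAt ℂ (G hR.1.eigenvalues) (v x₀) := by
    rw [hvp]
    unfold G
    refine analyticAt_const.mul (Finset.analyticAt_fun_sum _ fun i _ => ?_)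
    exact analyticAt_const.div (by fun_prop) (hp i)
  have hS : AnalyticAt ℂ S x₀ :=
    ((hGan.fun_comp hv).neg).div analyticAt_id hx0
  refine ⟨S, hS, ?_⟩
  have hTS : ∀ᶠ z in 𝓝 (x₀ : ℂ), 0 < z.im → canonicalT R c z = S z := by
    filter_upwards [hev] with z h1 h2
    rw [canonicalT_eq hM hR hc h2, ← h1.eq_uOf hM hlam hc h2]
  have hreal : Tendsto Complex.ofReal (𝓝 x₀) (𝓝 (x₀ : ℂ)) := Complex.continuous_ofReal.tendsto x₀
  -- For each real `x` near `x₀`, `S` is continuous at `x` and agrees with `t` on the part of a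
  -- neighbourhood of `x` in `ℂ⁺`, so both have the same limit there.
  filter_upwards [hreal.eventually hTS.eventually_nhds, hreal.eventually hS.eventually_analyticAt,
    eventually_gt_nhds hx₀] with x h1 h2 h3
  refine tendsto_nhds_unique (tendsto_boundaryT hM hR hc h3.ne') ?_
  refine (h2.continuousAt.tendsto.mono_left nhdsWithin_le_nhds).congr' ?_
  filter_upwards [eventually_nhdsWithin_of_eventually_nhds h1, self_mem_nhdsWithin] with z h4 h5
  exact (h4 h5).symm

theorem exists_power_series (hM : 0 < M) (hR : R.PosDef) (hc : 0 < c) {x₀ : ℝ} (hx₀ : 0 < x₀)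
    (him : 0 < (boundaryT R c x₀).im) :
    ∃ (a : ℕ → ℂ) (b : ℕ → ℝ) (ε : ℝ), 0 < ε ∧ ∀ x : ℝ, |x - x₀| < ε →
      HasSum (fun k : ℕ => a k * ((x : ℂ) - (x₀ : ℂ)) ^ k) (boundaryT R c x) ∧
      HasSum (fun k : ℕ => b k * (x - x₀) ^ k) (densityF R c x) := by
  obtain ⟨S, ⟨p, hp⟩, hbS⟩ := exists_analytic_extension hM hR hc hx₀ him
  have hreal : Tendsto Complex.ofReal (𝓝 x₀) (𝓝 (x₀ : ℂ)) := Complex.continuous_ofReal.tendsto x₀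
  obtain ⟨ε, hε, hball⟩ := Metric.eventually_nhds_iff.1
    ((hreal.eventually (hasFPowerSeriesAt_iff'.1 hp)).and hbS)
  -- Since `x - x₀` is real, taking imaginary parts acts on the coefficients alone.
  refine ⟨fun k => p.coeff k, fun k => 1 / Real.pi * (p.coeff k).im, ε, hε, fun x hx => ?_⟩
  obtain ⟨h1, h2⟩ := hball (y := x) (by rwa [Real.dist_eq])
  have h3 : HasSum (fun k : ℕ => p.coeff k * ((x : ℂ) - (x₀ : ℂ)) ^ k) (boundaryT R c x) := by
    rw [h2]
    refine h1.congr_fun fun k => ?_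
    rw [smul_eq_mul, mul_comm]
  refine ⟨h3, ?_⟩
  have h4 := (Complex.hasSum_im h3).mul_left (1 / Real.pi)
  refine h4.congr_fun fun k => ?_
  have : ((x : ℂ) - x₀) ^ k = (((x - x₀) ^ k : ℝ) : ℂ) := by push_cast; rfl
  rw [this, Complex.im_mul_ofReal, mul_assoc]

theorem analyticOnNhd_densityF (hM : 0 < M) (hR : R.PosDef) (hc : 0 < c) :
    AnalyticOnNhd ℝ (densityF R c) (bulkSet R c) := by
  rintro x₀ ⟨hx₀, him⟩
  obtain ⟨S, hS, hbS⟩ := exists_analytic_extension hM hR hc hx₀ him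
  have h1 : AnalyticAt ℝ (fun x : ℝ => S x) x₀ :=
    (hS.restrictScalars (𝕜 := ℝ)).fun_comp (Complex.ofRealCLM.analyticAt x₀)
  have h2 : AnalyticAt ℝ (fun x : ℝ => (S x).im) x₀ :=
    (Complex.imCLM.analyticAt _).fun_comp h1
  have h3 : AnalyticAt ℝ (fun x : ℝ => 1 / Real.pi * (S x).im) x₀ := analyticAt_const.fun_mul h2
  refine h3.congr ?_
  filter_upwards [hbS] with x hx
  rw [densityF, hx]

/-! ### The bulk and the support -/

lemma measure_eq_lintegral (hM : 0 < M) (hR : R.PosDef) (hc : 0 < c) {V : Set ℝ}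
    (hV : MeasurableSet V) (hV0 : V ⊆ Ioi 0) :
    canonicalMeasure R c V = ∫⁻ x in V, ENNReal.ofReal (densityF R c x) := by
  obtain ⟨hfin, -, hμ⟩ := isStieltjesMeasure_canonicalMeasure hM hR hc
  have h := congrArg (fun m : Measure ℝ => m V) (restrict_Ioi_eq_density hM hR hc hμ)
  simp only [Measure.restrict_apply hV, withDensity_apply _ hV, Measure.restrict_restrict hV,
    inter_eq_left.2 hV0] at h
  exact h

lemma densityF_pos_iff {x : ℝ} : 0 < densityF R c x ↔ 0 < (boundaryT R c x).im := by
  rw [densityF, mul_pos_iff_of_pos_left (by positivity)]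

lemma isOpen_bulkSet (hM : 0 < M) (hR : R.PosDef) (hc : 0 < c) : IsOpen (bulkSet R c) := by
  rw [isOpen_iff_mem_nhds]
  rintro x₀ ⟨hx₀, him⟩
  have h1 : ContinuousAt (boundaryT R c) x₀ :=
    (continuousOn_boundaryT hM hR hc).continuousAt (isOpen_ne.mem_nhds hx₀.ne')
  filter_upwards [eventually_gt_nhds hx₀,
    (Complex.continuous_im.continuousAt.comp h1).tendsto.eventually_const_lt him] with x h2 h3
  exact ⟨h2, h3⟩

lemma bulkSet_subset_support (hM : 0 < M) (hR : R.PosDef) (hc : 0 < c) :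
    bulkSet R c ⊆ (canonicalMeasure R c).support := by
  intro x hx
  rw [Measure.support_eq_forall_isOpen]
  intro V hxV hV
  have hW : IsOpen (V ∩ bulkSet R c) := hV.inter (isOpen_bulkSet hM hR hc)
  refine lt_of_lt_of_le ?_ (measure_mono (inter_subset_left (t := bulkSet R c)))
  rw [measure_eq_lintegral hM hR hc hW.measurableSet fun y hy => hy.2.1]
  have hmeas : AEMeasurable (fun x => ENNReal.ofReal (densityF R c x))
      (volume.restrict (V ∩ bulkSet R c)) :=
    ENNReal.measurable_ofReal.comp_aemeasurable
      (((continuousOn_densityF hM hR hc).mono fun y hy => hy.2.1.ne').aemeasurable hW.measurableSet)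
  rw [pos_iff_ne_zero]
  intro h0
  rw [lintegral_eq_zero_iff' hmeas] at h0
  have h1 : ∀ᵐ y ∂(volume.restrict (V ∩ bulkSet R c)), False := by
    filter_upwards [h0, ae_restrict_mem hW.measurableSet] with y h2 h3
    simp only [Pi.zero_apply, ENNReal.ofReal_eq_zero] at h2
    exact absurd (densityF_pos_iff.2 h3.2.2) (not_lt.2 h2)
  rw [eventually_false_iff_eq_bot, ae_eq_bot, Measure.restrict_eq_zero] at h1
  exact (hW.measure_pos volume ⟨x, hxV, hx⟩).ne' h1

lemma interior_support_subset_Ioi (hM : 0 < M) (hR : R.PosDef) (hc : 0 < c) :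
    interior (canonicalMeasure R c).support ⊆ Ioi 0 := by
  obtain ⟨-, h0, -⟩ := isStieltjesMeasure_canonicalMeasure hM hR hc
  have h1 : (canonicalMeasure R c).support ⊆ Ici 0 := by
    have := Measure.subset_compl_support_of_isOpen isOpen_Iio h0
    intro x hx
    by_contra hx0
    exact this (mem_Iio.2 (not_le.1 hx0)) hx
  exact (interior_mono h1).trans interior_Ici.subset

lemma bulkSet_eq (hM : 0 < M) (hR : R.PosDef) (hc : 0 < c) :
    bulkSet R c = {x ∈ interior (canonicalMeasure R c).support | densityF R c x ≠ 0} := by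
  ext x
  constructor
  · intro hx
    exact ⟨interior_maximal (bulkSet_subset_support hM hR hc) (isOpen_bulkSet hM hR hc) hx,
      (densityF_pos_iff.2 hx.2).ne'⟩
  · rintro ⟨hx, hne⟩
    have hx0 : 0 < x := interior_support_subset_Ioi hM hR hc hx
    refine ⟨hx0, lt_of_le_of_ne (boundaryT_im_nonneg hM hR hc hx0.ne') fun h => hne ?_⟩
    rw [densityF, ← h, mul_zero]

/-- On the part of the interior of the support outside the closure of the bulk the density vanishes,
so this open set is null; an open set meeting the support cannot be. -/
lemma interior_support_subset_closure (hM : 0 < M) (hR : R.PosDef) (hc : 0 < c) :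
    interior (canonicalMeasure R c).support ⊆ closure (bulkSet R c) := by
  intro x hx
  by_contra hcl
  set V := interior (canonicalMeasure R c).support ∩ (closure (bulkSet R c))ᶜ
  have hV : IsOpen V := isOpen_interior.inter isClosed_closure.isOpen_compl
  have hV0 : V ⊆ Ioi 0 := fun y hy => interior_support_subset_Ioi hM hR hc hy.1
  have hpos : 0 < canonicalMeasure R c V := by
    have := interior_subset hx
    rw [Measure.support_eq_forall_isOpen] at this
    exact this V ⟨hx, hcl⟩ hV
  rw [measure_eq_lintegral hM hR hc hV.measurableSet hV0] at hpos
  refine hpos.ne' ((setLIntegral_congr_fun hV.measurableSet fun y hy => ?_).trans lintegral_zero)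
  have h1 : y ∉ bulkSet R c := fun h => hy.2 (subset_closure h)
  have h2 : ¬ 0 < (boundaryT R c y).im := fun h => h1 ⟨hV0 hy, h⟩
  rw [← densityF_pos_iff, not_lt] at h2
  exact ENNReal.ofReal_eq_zero.2 h2

end CanonicalCurve

end

theorem mainTheorem12 {M : ℕ} (hM : 0 < M) (R : Matrix (Fin M) (Fin M) ℂ) (hR : R.PosDef)
    (c : ℝ) (hc : 0 < c) :
    -- `t(z)` is the unique solution of the canonical equation, for every `z` in `ℂ⁺`
    (∀ z : ℂ, 0 < z.im → IsCanonicalSolution R c z (canonicalT R c z) ∧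
      ∀ s : ℂ, IsCanonicalSolution R c z s → s = canonicalT R c z) ∧
    -- `t` is the Stieltjes transform of the finite measure `μ`, carried by `[0, ∞)`
    IsStieltjesMeasure (canonicalMeasure R c) (canonicalT R c) ∧
    -- the limit `t(x)` exists for every `x > 0`
    (∀ x : ℝ, 0 < x →
      Tendsto (canonicalT R c) (𝓝[{z : ℂ | 0 < z.im}] (x : ℂ)) (𝓝 (boundaryT R c x))) ∧
    -- `f` is the (continuous) density of `μ` on `(0, ∞)`
    ContinuousOn (densityF R c) (Ioi 0) ∧
    (canonicalMeasure R c).restrict (Ioi 0) =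
      (volume.restrict (Ioi 0)).withDensity (fun x => ENNReal.ofReal (densityF R c x)) ∧
    -- power series expansions of `t` and `f` around `x₀`
    (∀ x₀ : ℝ, 0 < x₀ → 0 < (boundaryT R c x₀).im →
      ∃ (a : ℕ → ℂ) (b : ℕ → ℝ) (ε : ℝ), 0 < ε ∧ ∀ x : ℝ, |x - x₀| < ε →
        HasSum (fun k : ℕ => a k * ((x : ℂ) - (x₀ : ℂ)) ^ k) (boundaryT R c x) ∧
        HasSum (fun k : ℕ => b k * (x - x₀) ^ k) (densityF R c x)) ∧
    -- real analyticity of the density, and the place of the analyticity set in the support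
    AnalyticOnNhd ℝ (densityF R c) (bulkSet R c) ∧
    bulkSet R c = {x ∈ interior (canonicalMeasure R c).support | densityF R c x ≠ 0} ∧
    interior (canonicalMeasure R c).support ⊆ closure (bulkSet R c) := by
  open CanonicalCurve in
  exact ⟨fun z hz => ⟨isCanonicalSolution_canonicalT hM hR hc hz, fun s hs =>
      (isCanonicalSolution_unique hM hR hc hz hs).trans (canonicalT_eq hM hR hc hz).symm⟩,
    isStieltjesMeasure_canonicalMeasure hM hR hc,
    fun x hx => tendsto_boundaryT hM hR hc hx.ne',
    (continuousOn_densityF hM hR hc).mono fun x hx => (mem_Ioi.1 hx).ne',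
    have : IsFiniteMeasure (canonicalMeasure R c) := (isStieltjesMeasure_canonicalMeasure hM hR hc).1
    restrict_Ioi_eq_density hM hR hc (isStieltjesMeasure_canonicalMeasure hM hR hc).2.2,
    fun x₀ hx₀ him => exists_power_series hM hR hc hx₀ him,
    analyticOnNhd_densityF hM hR hc,
    bulkSet_eq hM hR hc,
    interior_support_subset_closure hM hR hc⟩
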